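/- \textbf{Theorem 4 (SFR, interior user).} Consider a cellular downlink in which the base stations form a homogeneous Poisson point process of intensity $\lambda>0$ in the plane. The user is at the origin and is served by its closest base station $y$, at distance $r$. The fading gains $g_z$ from the base stations $z$ to the user are i.i.d. exponential with rate $\mu>0$ (mean $1/\mu$) and independent of the base station locations. Let $P>0$ be the transmit power of the serving station, $\sigma^2\ge 0$ the noise power and $\alpha>2$ the path loss exponent, and let $R_z$ be the distance of station $z$ from the user. Soft frequency reuse (SFR) with reuse factor $\Delta\in\mathbb{N}$, $\Delta\ge1$, and power control factor $\beta\ge 1$ enters through the effective interference power factor $\eta=(\Delta-1+\beta)/\Delta$. The SINR of a user served at the interior power $P$ is $$\mathrm{SINR}=\frac{P g_y r^{-\alpha}}{\sigma^2+\eta P I_r},\qquad I_r=\sum_{z\ne y} g_z R_z^{-\alpha}.$$ Let $T\in\mathbb{R}$ and $T_{FR}>0$. The user is an interior user if $\mathrm{SINR}>T_{FR}$, and the coverage probability of an interior user is $\bar F_{\mathrm{SFR},i}(T)=\mathbb{P}(\mathrm{SINR}>T\mid \mathrm{SINR}>T_{FR})$. For a common transmit power $Q>0$ of the base stations let $$p_c(x,\lambda,\alpha,\Delta;Q)=\pi\lambda\int_0^\infty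 e^{-\pi\lambda v\left(1+\frac1\Delta\rho(x,\alpha)\right)-\mu x\frac{\sigma^2}{Q}v^{\alpha/2}}\,dv,\qquad \rho(x,\alpha)=x^{2/\alpha}\int_{x^{-2/\alpha}}^\infty\frac{du}{1+u^{\alpha/2}}.$$ Then almost surely the closest base station is unique and the series $I_r$ converges, the event $\{\mathrm{SINR}>T_{FR}\}$ has positive probability, and $$\bar F_{\mathrm{SFR},i}(T)=\frac{p_c(\eta\max\{T,T_{FR}\},\lambda,\alpha,1;\eta P)}{p_c(\eta T_{FR},\lambda,\alpha,1;\eta P)}.$$ The transmit power enters $p_c$ only through the noise term, so it plays no role if $\sigma^2=0$, and $\eta P=P$ if $\beta=1$. -/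

import Mathlib

open MeasureTheory ProbabilityTheory Set
open scoped NNReal ENNReal

noncomputable section

/-- The plane in which the base stations lie, with its Euclidean norm. The mobile user in
consideration sits at the origin. -/
abbrev Plane : Type := EuclideanSpace ℝ (Fin 2)

section Network

variable {Ω : Type*} [MeasurableSpace Ω]

/-- Number of points (indices) of the random sequence `X` that fall in `B`. -/
def pointCount (X : ℕ → Ω → Plane) (B : Set Plane) (ω : Ω) : ℕ∞ :=
  {i : ℕ | X i ω ∈ B}.encard

/-- The points `X 0, X 1, …` form a homogeneous Poisson point process of intensity `lam` in the
plane: the number of points in a Borel set `B` of finite area is Poisson distributed with parameter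
`lam * area B`, and the numbers of points in disjoint Borel sets of finite area are independent.
The order in which the points are enumerated is arbitrary. -/
structure IsPoissonPointProcess (Pr : Measure Ω) (lam : ℝ) (X : ℕ → Ω → Plane) : Prop where
  measurable_point : ∀ i, Measurable (X i)
  count_law : ∀ B : Set Plane, MeasurableSet B → volume B < ∞ → ∀ k : ℕ,
    Pr {ω | pointCount X B ω = k} = poissonMeasure (lam * volume.real B).toNNReal {k}
  count_indep : ∀ (n : ℕ) (B : Fin n → Set Plane), (∀ j, MeasurableSet (B j)) →
    (∀ j, volume (B j) < ∞) → Pairwise (fun i j => Disjoint (B i) (B j)) →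
    iIndepFun (fun j => pointCount X (B j)) Pr

/-- A cellular downlink: the base stations `X i` form a Poisson point process of intensity `lam`;
the fading power gains `g i` from the stations to the user are i.i.d. exponential with rate `μ`
(Rayleigh fading) and independent of the station locations. -/
structure IsRayleighPoissonNetwork (Pr : Measure Ω) (lam μ : ℝ)
    (X : ℕ → Ω → Plane) (g : ℕ → Ω → ℝ) : Prop where
  stations : IsPoissonPointProcess Pr lam X
  measurable_fading : ∀ i, Measurable (g i)
  fading_law : ∀ i, Pr.map (g i) = expMeasure μ
  fading_indep : iIndepFun g Pr
  stations_indep_fading : IndepFun (fun ω i => X i ω) (fun ω i => g i ω) Pr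

/-- Station `i` is a closest station to the user. -/
def IsClosest (X : ℕ → Ω → Plane) (ω : Ω) (i : ℕ) : Prop :=
  ∀ j, ‖X i ω‖ ≤ ‖X j ω‖

/-- The serving base station: the closest one. -/
def serving (X : ℕ → Ω → Plane) (ω : Ω) : ℕ :=
  sInf {i | IsClosest X ω i}

/-- Received unit-power gain `g_z R_z ^ (-α)` of station `z`, if `z` is an interferer (any station
other than the serving one, as all sub-bands are reused in every cell), and `0` otherwise. -/
def interferenceTerm (α : ℝ) (X : ℕ → Ω → Plane) (g : ℕ → Ω → ℝ) (ω : Ω) (z : ℕ) : ℝ :=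
  if z = serving X ω then 0 else g z ω * ‖X z ω‖ ^ (-α)

/-- The interference `I_r = ∑ g_z R_z ^ (-α)` over all stations other than the serving one. -/
def interference (α : ℝ) (X : ℕ → Ω → Plane) (g : ℕ → Ω → ℝ) (ω : Ω) : ℝ :=
  ∑' z, interferenceTerm α X g ω z

/-- The effective interference power factor `η = (Δ - 1 + β) / Δ` of soft frequency reuse. -/
def effectiveFactor (Δ : ℕ) (β : ℝ) : ℝ := ((Δ : ℝ) - 1 + β) / Δ

/-- The SINR of a user that is served at the interior power `P` under soft frequency reuse with
reuse factor `Δ` and power control factor `β`: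
`P g_y r ^ (-α) / (σ ^ 2 + η P I_r)`. -/
def sfrSINR (P σ α : ℝ) (Δ : ℕ) (β : ℝ) (X : ℕ → Ω → Plane) (g : ℕ → Ω → ℝ) (ω : Ω) : ℝ :=
  P * g (serving X ω) ω * ‖X (serving X ω) ω‖ ^ (-α) /
    (σ ^ 2 + effectiveFactor Δ β * P * interference α X g ω)

/-- The users whose SINR exceeds the threshold `TR` are the interior users. -/
def sfrInterior (P σ α : ℝ) (Δ : ℕ) (β TR : ℝ) (X : ℕ → Ω → Plane) (g : ℕ → Ω → ℝ) : Set Ω :=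
  {ω | TR < sfrSINR P σ α Δ β X g ω}

/-- Coverage probability of an interior user: the conditional probability of `SINR > T`, given that
the user is an interior user. -/
def sfrInteriorCoverage (Pr : Measure Ω) (P σ α : ℝ) (Δ : ℕ) (β TR T : ℝ)
    (X : ℕ → Ω → Plane) (g : ℕ → Ω → ℝ) : ℝ :=
  (Pr[|sfrInterior P σ α Δ β TR X g]).real {ω | T < sfrSINR P σ α Δ β X g ω}

end Network

/-- `ρ(T, α) = T ^ (2/α) ∫_{T ^ (-2/α)}^∞ 1 / (1 + u ^ (α/2)) du`. -/
def rhoFactor (T α : ℝ) : ℝ :=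
  T ^ (2 / α) * ∫ u in Ioi (T ^ (-2 / α)), 1 / (1 + u ^ (α / 2))

/-- The coverage function
`p_c(T, λ, α, Δ) = π λ ∫_0^∞ exp (-π λ v (1 + ρ(T, α) / Δ) - μ T (σ ^ 2 / P) v ^ (α/2)) dv`,
with its dependence on the fading rate `μ`, the noise power `σ ^ 2` and the common transmit
power `P` of the base stations made explicit. -/
def coverageFn (μ σ P T lam α : ℝ) (Δ : ℕ) : ℝ :=
  Real.pi * lam * ∫ v in Ioi (0 : ℝ),
    Real.exp (-Real.pi * lam * v * (1 + 1 / (Δ : ℝ) * rhoFactor T α)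
      - μ * T * (σ ^ 2 / P) * v ^ (α / 2))

end

noncomputable section

open Filter Topology

/-! Solved for the gain of the serving station, SINR > t reads g_y > t (σ²/P) r^α + η t ∑ (r/R_z)^α
g_z. For fixed locations, the exponential tail of g_y and the Laplace transforms of the other gains
give this event the probability exp(-μ t (σ²/P) r^α) ∏ 1/(1 + η t (r/R_z)^α)
(`measure_add_tsum_lt_serving`). The squared distances of a planar Poisson process have constant
intensity πλ; the least of them, s, has density πλ exp(-πλs), and beyond it lies an independent
Poisson process, whose Laplace functional turns the product into exp(-πλ s ρ(ηt, α))
(`lintegral_serving`, `lintegral_one_sub_expNeg_pathLoss`). Integrating over s gives P(SINR > t) =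
p_c(ηt, λ, α, 1; ηP) for t > 0 (`measure_lt_sfrSINR`). The conditional probability is a quotient of
two such values, because exceeding T and T_FR means exceeding their maximum.

Conditioning on the closest point is replaced by a discretization: the axis of squared distances is
cut into dyadic cells, the event that the first occupied cell holds exactly one point is expressed
by counts in disjoint sets, and the cells are refined. With all exponents zero the same limit has
total mass 1, which yields the almost sure uniqueness of the closest station.

Sums are taken in [0, ∞], so convergence of I_r is a conclusion: the probability that c ∑ (r/R_z)^α
g_z < g_y is 1/(1 + ρ(c, α)), which tends to 1 as c → 0. -/

/-! ### The exponential exp(-x) for x in [0, ∞] -/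

/-- The function `x ↦ exp (-x)` on `[0, ∞]`, with values in `[0, 1]`. -/
def expNeg (x : ℝ≥0∞) : ℝ≥0∞ := (EReal.exp (x : EReal))⁻¹

@[simp] lemma expNeg_zero : expNeg 0 = 1 := by simp [expNeg]

@[simp] lemma expNeg_top : expNeg ∞ = 0 := by simp [expNeg]

lemma expNeg_add (x y : ℝ≥0∞) : expNeg (x + y) = expNeg x * expNeg y := by
  simp only [expNeg, EReal.coe_ennreal_add, EReal.exp_add]
  refine ENNReal.mul_inv (Or.inl ?_) (Or.inr ?_)
  · simp
  · simp

lemma expNeg_antitone : Antitone expNeg := fun x y h => by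
  simp only [expNeg, ENNReal.inv_le_inv]
  exact EReal.exp_monotone (EReal.coe_ennreal_le_coe_ennreal_iff.2 h)

lemma expNeg_le_one (x : ℝ≥0∞) : expNeg x ≤ 1 := by
  simpa using expNeg_antitone (zero_le (a := x))

lemma expNeg_ofReal {x : ℝ} (hx : 0 ≤ x) :
    expNeg (ENNReal.ofReal x) = ENNReal.ofReal (Real.exp (-x)) := by
  rw [expNeg, EReal.coe_ennreal_ofReal, max_eq_left hx, EReal.exp_coe, Real.exp_neg,
    ENNReal.ofReal_inv_of_pos (Real.exp_pos x)]

lemma continuous_expNeg : Continuous expNeg :=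
  continuous_inv.comp (ENNReal.continuous_exp.comp continuous_coe_ennreal_ereal)

lemma measurable_expNeg : Measurable expNeg := continuous_expNeg.measurable

lemma expNeg_sum {ι : Type*} (s : Finset ι) (f : ι → ℝ≥0∞) :
    expNeg (∑ i ∈ s, f i) = ∏ i ∈ s, expNeg (f i) := by
  classical
  induction s using Finset.induction_on with
  | empty => simp
  | insert a s ha ih => rw [Finset.sum_insert ha, Finset.prod_insert ha, expNeg_add, ih]

lemma expNeg_mul_natCast (x : ℝ≥0∞) (k : ℕ) : expNeg (x * k) = expNeg x ^ k := by
  induction k with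
  | zero => simp
  | succ k ih => rw [Nat.cast_succ, mul_add, mul_one, expNeg_add, ih, pow_succ]

lemma expNeg_tsum_eq_tendsto (f : ℕ → ℝ≥0∞) :
    Tendsto (fun m => expNeg (∑ i ∈ Finset.range m, f i)) atTop (𝓝 (expNeg (∑' i, f i))) :=
  (continuous_expNeg.tendsto _).comp (ENNReal.tendsto_nat_tsum f)

/-! ### Laplace functional of the Poisson process -/

section Poisson

variable {Ω : Type*}

lemma toENNReal_pointCount (X : ℕ → Ω → Plane) (B : Set Plane) (ω : Ω) :
    (pointCount X B ω : ℝ≥0∞) = ∑' i, B.indicator 1 (X i ω) := by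
  have h := ENNReal.tsum_set_one {i : ℕ | X i ω ∈ B}
  rw [pointCount, ← h, tsum_subtype {i : ℕ | X i ω ∈ B} (fun _ => (1 : ℝ≥0∞))]
  rfl

variable [MeasurableSpace Ω]

lemma measurable_pointCount {X : ℕ → Ω → Plane} (hX : ∀ i, Measurable (X i)) {B : Set Plane}
    (hB : MeasurableSet B) : Measurable (pointCount X B) := by
  have h : Measurable fun ω => (pointCount X B ω : ℝ≥0∞) := by
    simp_rw [toENNReal_pointCount]
    exact Measurable.tsum fun i => (measurable_one.indicator hB).comp (hX i)
  refine measurable_to_countable' fun k => ?_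
  have : pointCount X B ⁻¹' {k} = (fun ω => (pointCount X B ω : ℝ≥0∞)) ⁻¹' {(k : ℝ≥0∞)} := by
    ext ω; simp
  rw [this]
  exact h (measurableSet_singleton _)

variable {Pr : Measure Ω} {lam : ℝ} {X : ℕ → Ω → Plane}

lemma lintegral_poissonMeasure (m : ℝ≥0) (u : ℕ → ℝ≥0∞) :
    ∫⁻ k, u k ∂(poissonMeasure m) =
      ∑' k, ENNReal.ofReal (Real.exp (-m) * m ^ k / k.factorial) * u k := by
  simp [poissonMeasure]

/-- This is the Poisson generating function exp(-m(1 - q)) at q = exp(-c). The value c = ∞, that is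
q = 0, is included and gives void probabilities. -/
lemma lintegral_expNeg_poissonMeasure (m : ℝ≥0) (c : ℝ≥0∞) :
    ∫⁻ k : ℕ, expNeg (c * k) ∂(poissonMeasure m) = expNeg (m * (1 - expNeg c)) := by
  rw [lintegral_poissonMeasure]
  obtain ⟨q, hq⟩ : ∃ q : ℝ≥0, expNeg c = q :=
    ⟨_, (ENNReal.coe_toNNReal (ne_top_of_le_ne_top ENNReal.one_ne_top (expNeg_le_one c))).symm⟩
  have hq1 : q ≤ 1 := by
    have := expNeg_le_one c
    rw [hq] at this; exact_mod_cast this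
  have hq1' : (q : ℝ) ≤ 1 := by exact_mod_cast hq1
  simp_rw [expNeg_mul_natCast, hq]
  have e1 : (m : ℝ≥0∞) * (1 - q) = ENNReal.ofReal (m * (1 - q)) := by
    rw [ENNReal.ofReal_mul NNReal.zero_le_coe, ENNReal.ofReal_sub _ NNReal.zero_le_coe]
    simp
  rw [e1, expNeg_ofReal (mul_nonneg NNReal.zero_le_coe (by linarith))]
  have e2 : ∀ k : ℕ, ENNReal.ofReal (Real.exp (-m) * m ^ k / k.factorial) * (q : ℝ≥0∞) ^ k
      = ENNReal.ofReal (Real.exp (-m) * ((m * q : ℝ) ^ k / k.factorial)) := by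
    intro k
    rw [← ENNReal.ofReal_coe_nnreal, ← ENNReal.ofReal_pow NNReal.zero_le_coe, ← ENNReal.ofReal_mul (by positivity)]
    congr 1; rw [mul_pow]; ring
  simp_rw [e2]
  have hs := (NormedSpace.expSeries_div_hasSum_exp (m * q : ℝ)).mul_left (Real.exp (-m))
  rw [← ENNReal.ofReal_tsum_of_nonneg (fun k => by positivity) hs.summable, hs.tsum_eq,
    ← Real.exp_eq_exp_ℝ, ← Real.exp_add]
  congr 2; ring

namespace IsPoissonPointProcess

lemma map_pointCount [IsProbabilityMeasure Pr] (h : IsPoissonPointProcess Pr lam X) {B : Set Plane} (hB : MeasurableSet B)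
    (hB' : volume B < ∞) :
    Pr.map (pointCount X B) =
      (poissonMeasure (lam * volume.real B).toNNReal).map (Nat.cast : ℕ → ℕ∞) := by
  have hm := measurable_pointCount h.measurable_point hB
  have hnat : ∀ k : ℕ, Pr.map (pointCount X B) {(k : ℕ∞)} =
      (poissonMeasure (lam * volume.real B).toNNReal).map (Nat.cast : ℕ → ℕ∞) {(k : ℕ∞)} := by
    intro k
    rw [Measure.map_apply hm (measurableSet_singleton _),
      Measure.map_apply (measurable_from_top) (measurableSet_singleton _)]
    have : (Nat.cast : ℕ → ℕ∞) ⁻¹' {(k : ℕ∞)} = {k} := by ext; simp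
    rw [this, ← h.count_law B hB hB' k]
    rfl
  have := Measure.isProbabilityMeasure_map (μ := Pr) hm.aemeasurable
  have := Measure.isProbabilityMeasure_map
    (μ := poissonMeasure (lam * volume.real B).toNNReal) (f := (Nat.cast : ℕ → ℕ∞))
    measurable_from_top.aemeasurable
  refine Measure.ext_of_singleton fun k => ?_
  induction k using ENat.recTopCoe with
  | coe k => exact hnat k
  | top =>
    -- The law of the counts is prescribed at finite values only; as both sides are probability
    -- measures, the mass at ⊤ is the complement.
    have htop : ({⊤} : Set ℕ∞) = (⋃ k : ℕ, {(k : ℕ∞)})ᶜ := by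
      ext k; induction k using ENat.recTopCoe <;> simp
    rw [htop, prob_compl_eq_one_sub (MeasurableSet.of_discrete), prob_compl_eq_one_sub (MeasurableSet.of_discrete),
      measure_iUnion (fun i j hij => by simpa using hij) (fun _ => MeasurableSet.of_discrete),
      measure_iUnion (fun i j hij => by simpa using hij) (fun _ => MeasurableSet.of_discrete)]
    simp_rw [hnat]

lemma lintegral_pointCount [IsProbabilityMeasure Pr] (h : IsPoissonPointProcess Pr lam X) {B : Set Plane}
    (hB : MeasurableSet B) (hB' : volume B < ∞) (u : ℕ∞ → ℝ≥0∞) :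
    ∫⁻ ω, u (pointCount X B ω) ∂Pr =
      ∫⁻ k : ℕ, u k ∂(poissonMeasure (lam * volume.real B).toNNReal) := by
  rw [← lintegral_map (f := u) measurable_from_top (measurable_pointCount h.measurable_point hB),
    h.map_pointCount hB hB', lintegral_map measurable_from_top measurable_from_top]

lemma iIndepFun_pointCount (h : IsPoissonPointProcess Pr lam X) {ι : Type*} [Fintype ι]
    {B : ι → Set Plane} (hB : ∀ j, MeasurableSet (B j)) (hB' : ∀ j, volume (B j) < ∞)
    (hd : Pairwise fun i j => Disjoint (B i) (B j)) :
    iIndepFun (fun j => pointCount X (B j)) Pr := by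
  have e := (Fintype.equivFin ι).symm
  have := h.count_indep _ (fun j => B (e j)) (fun j => hB _) (fun j => hB' _)
    (fun i j hij => hd (e.injective.ne hij))
  exact iIndepFun.of_precomp e.surjective this

/-- Independence of the counts in disjoint sets, in terms of integrals. -/
lemma lintegral_prod_pointCount (h : IsPoissonPointProcess Pr lam X) {ι : Type*} [Fintype ι]
    {B : ι → Set Plane} (hB : ∀ j, MeasurableSet (B j)) (hB' : ∀ j, volume (B j) < ∞)
    (hd : Pairwise fun i j => Disjoint (B i) (B j)) (u : ι → ℕ∞ → ℝ≥0∞) :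
    ∫⁻ ω, ∏ j, u j (pointCount X (B j) ω) ∂Pr =
      ∏ j, ∫⁻ ω, u j (pointCount X (B j) ω) ∂Pr :=
  lintegral_prod_eq_prod_lintegral_of_indepFun _ (fun j ω => u j (pointCount X (B j) ω))
    ((h.iIndepFun_pointCount hB hB' hd).comp u fun _ => measurable_from_top)
    fun j => measurable_from_top.comp (measurable_pointCount h.measurable_point (hB j))

/-- The fibres of `f` inside `S`, together with `B`, are finitely many disjoint sets of finite area.
The shot noise is a linear combination of the counts in the fibres, so everything factorizes over
the cells. -/
lemma lintegral_one_point_mul_expNeg_simpleFunc [IsProbabilityMeasure Pr]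
    (h : IsPoissonPointProcess Pr lam X)
    (hlam : 0 ≤ lam) {B S : Set Plane} (hB : MeasurableSet B) (hB' : volume B < ∞)
    (hS : MeasurableSet S) (hS' : volume S < ∞) (hd : Disjoint B S)
    (f : SimpleFunc Plane ℝ≥0∞) :
    ∫⁻ ω, (if pointCount X B ω = 1 then 1 else 0) *
        expNeg (∑' i, S.indicator f (X i ω)) ∂Pr =
      (∫⁻ ω, (if pointCount X B ω = 1 then 1 else 0) ∂Pr) *
        expNeg (ENNReal.ofReal lam * ∫⁻ x, 1 - expNeg (S.indicator f x)) := by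
  let C : Option f.range → Set Plane := fun o => o.elim B fun c => f ⁻¹' {c.1} ∩ S
  let u : Option f.range → ℕ∞ → ℝ≥0∞ := fun o k =>
    o.elim (if k = 1 then 1 else 0) fun c => expNeg (c.1 * k)
  have hCm : ∀ o, MeasurableSet (C o) := by
    rintro (_ | c)
    exacts [hB, (f.measurableSet_fiber _).inter hS]
  have hCf : ∀ o, volume (C o) < ∞ := by
    rintro (_ | c)
    exacts [hB', (measure_mono inter_subset_right).trans_lt hS']
  have hCd : Pairwise fun i j => Disjoint (C i) (C j) := by
    rintro (_ | c) (_ | d) hcd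
    · exact absurd rfl hcd
    · exact hd.mono_right inter_subset_right
    · exact hd.symm.mono_left inter_subset_right
    · refine Set.disjoint_left.2 fun x hx hx' => hcd ?_
      have : (c : ℝ≥0∞) = d := hx.1.symm.trans hx'.1
      rw [Subtype.ext this]
  have key := h.lintegral_prod_pointCount hCm hCf hCd u
  have hsum : ∀ ω, ∑' i, S.indicator f (X i ω) =
      ∑ c : f.range, (c : ℝ≥0∞) * pointCount X (C (some c)) ω := by
    intro ω
    simp_rw [toENNReal_pointCount, ← ENNReal.tsum_mul_left]
    rw [← Summable.tsum_finsetSum (fun _ _ => ENNReal.summable)]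
    congr 1 with i
    by_cases hx : X i ω ∈ S
    · rw [Finset.sum_eq_single ⟨f (X i ω), f.mem_range_self _⟩]
      · simp [C, hx]
      · rintro c - hc
        have : f (X i ω) ≠ c := fun h => hc (Subtype.ext h.symm)
        simp [C, this]
      · simp
    · simp [C, hx]
  have hint : ∀ c : f.range, ∫⁻ ω, expNeg (c * pointCount X (C (some c)) ω) ∂Pr =
      expNeg (ENNReal.ofReal lam * ((1 - expNeg c) * volume (f ⁻¹' {c.1} ∩ S))) := by
    intro c
    rw [h.lintegral_pointCount (hCm _) (hCf _) (fun k => expNeg (c * k))]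
    simp only [ENat.toENNReal_coe]
    rw [lintegral_expNeg_poissonMeasure]
    congr 1
    have : ((lam * volume.real (C (some c))).toNNReal : ℝ≥0∞) =
        ENNReal.ofReal lam * volume (C (some c)) := by
      rw [← ENNReal.ofReal, ENNReal.ofReal_mul hlam, measureReal_def,
        ENNReal.ofReal_toReal (hCf _).ne]
    rw [this]
    simp only [C, Option.elim]
    ring
  have hvol : ∫⁻ x, 1 - expNeg (S.indicator f x) =
      ∑ c : f.range, (1 - expNeg c) * volume (f ⁻¹' {c.1} ∩ S) := by
    have : (fun x => 1 - expNeg (S.indicator f x)) = S.indicator (f.map fun c => 1 - expNeg c) := by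
      ext x
      by_cases hx : x ∈ S <;> simp [hx]
    rw [this, lintegral_indicator hS, SimpleFunc.lintegral_eq_lintegral, SimpleFunc.map_lintegral,
      ← Finset.sum_coe_sort]
    refine Finset.sum_congr rfl fun c _ => ?_
    rw [Measure.restrict_apply (f.measurableSet_fiber _)]
  simp_rw [Fintype.prod_option] at key
  simp only [C, u, Option.elim] at key
  rw [hvol, Finset.mul_sum, expNeg_sum, ← Finset.prod_congr rfl fun c _ => hint c]
  refine Eq.trans ?_ key
  refine lintegral_congr fun ω => ?_
  rw [hsum, expNeg_sum]
  rfl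

lemma lintegral_pointCount_eq_one [IsProbabilityMeasure Pr] (h : IsPoissonPointProcess Pr lam X)
    (hlam : 0 ≤ lam) {B : Set Plane} (hB : MeasurableSet B) (hB' : volume B < ∞) :
    ∫⁻ ω, (if pointCount X B ω = 1 then 1 else 0) ∂Pr =
      ENNReal.ofReal (Real.exp (-(lam * volume.real B)) * (lam * volume.real B)) := by
  rw [h.lintegral_pointCount hB hB' (fun k => if k = 1 then 1 else 0), lintegral_poissonMeasure,
    tsum_eq_single 1 (fun k hk => by simp [hk])]
  simp [Real.coe_toNNReal _ (mul_nonneg hlam measureReal_nonneg)]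

/-- Joint law of the event that `B` contains exactly one point and of the shot noise of a function
`f` that vanishes on `B`: the two are independent, and the Laplace functional of the Poisson
process is `exp (-lam * ∫ (1 - exp (-f)))`. -/
lemma lintegral_one_point_mul_expNeg [IsProbabilityMeasure Pr] (h : IsPoissonPointProcess Pr lam X)
    (hlam : 0 ≤ lam) {B : Set Plane} (hB : MeasurableSet B) (hB' : volume B < ∞)
    {f : Plane → ℝ≥0∞} (hf : Measurable f) (hfB : ∀ x ∈ B, f x = 0) :
    ∫⁻ ω, (if pointCount X B ω = 1 then 1 else 0) * expNeg (∑' i, f (X i ω)) ∂Pr =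
      (∫⁻ ω, (if pointCount X B ω = 1 then 1 else 0) ∂Pr) *
        expNeg (ENNReal.ofReal lam * ∫⁻ x, 1 - expNeg (f x)) := by
  -- Balls make the areas finite, and removing `B` costs nothing since `f` vanishes there. Monotone
  -- convergence handles the exponents, dominated convergence the outer expectation.
  let S : ℕ → Set Plane := fun n => Metric.ball 0 n \ B
  have hS : ∀ n, MeasurableSet (S n) := fun n => measurableSet_ball.diff hB
  have hS' : ∀ n, volume (S n) < ∞ := fun n =>
    (measure_mono sdiff_subset).trans_lt measure_ball_lt_top
  let φ : ℕ → Plane → ℝ≥0∞ := fun n => (S n).indicator (SimpleFunc.eapprox f n)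
  have hφm : ∀ n, Measurable (φ n) := fun n => (SimpleFunc.measurable _).indicator (hS n)
  have hφmono : Monotone φ := by
    intro m n hmn x
    refine (indicator_le_indicator_of_subset (sdiff_subset_sdiff_left
      (Metric.ball_subset_ball (Nat.cast_le.2 hmn))) (fun _ => zero_le) x).trans ?_
    exact indicator_le_indicator (SimpleFunc.monotone_eapprox f hmn x)
  have hφlim : ∀ x, Tendsto (fun n => φ n x) atTop (𝓝 (f x)) := by
    intro x
    by_cases hx : x ∈ B
    · simp [φ, S, hx, hfB x hx]
    · refine (SimpleFunc.tendsto_eapprox hf x).congr' ?_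
      obtain ⟨N, hN⟩ := exists_nat_gt ‖x‖
      filter_upwards [eventually_ge_atTop N] with n hn
      have : x ∈ S n := ⟨by simpa using hN.trans_le (by exact_mod_cast hn), hx⟩
      simp [φ, this]
  have key := fun n => h.lintegral_one_point_mul_expNeg_simpleFunc hlam hB hB' (hS n) (hS' n)
    disjoint_sdiff_right (SimpleFunc.eapprox f n)
  have hcm : Measurable fun ω => (if pointCount X B ω = 1 then (1 : ℝ≥0∞) else 0) :=
    measurable_from_top.comp (g := fun k : ℕ∞ => if k = 1 then (1 : ℝ≥0∞) else 0)
      (measurable_pointCount h.measurable_point hB)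
  have htsum : ∀ ω, Tendsto (fun n => ∑' i, φ n (X i ω)) atTop (𝓝 (∑' i, f (X i ω))) := by
    intro ω
    simp_rw [← lintegral_count]
    exact lintegral_tendsto_of_tendsto_of_monotone (fun n => measurable_from_top.aemeasurable)
      (ae_of_all _ fun i m n hmn => hφmono hmn _) (ae_of_all _ fun i => hφlim _)
  refine tendsto_nhds_unique (f := fun n => ∫⁻ ω, (if pointCount X B ω = 1 then 1 else 0) *
        expNeg (∑' i, φ n (X i ω)) ∂Pr) (l := atTop) ?_ ?_
  · refine tendsto_lintegral_of_dominated_convergence (fun _ => 1) (fun n => ?_)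
      (fun n => ae_of_all _ fun ω => ?_) (by simp) (ae_of_all _ fun ω => ?_)
    · exact hcm.mul (measurable_expNeg.comp
        (Measurable.tsum fun i => (hφm n).comp (h.measurable_point i)))
    · refine mul_le_one' ?_ (expNeg_le_one _)
      split_ifs <;> simp
    · refine ENNReal.Tendsto.const_mul ((continuous_expNeg.tendsto _).comp (htsum ω)) (Or.inr ?_)
      split_ifs <;> simp
  · simp_rw [φ, key]
    refine ENNReal.Tendsto.const_mul ((continuous_expNeg.tendsto _).comp
      (ENNReal.Tendsto.const_mul ?_ (Or.inr ENNReal.ofReal_ne_top))) (Or.inr ?_)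
    · refine lintegral_tendsto_of_tendsto_of_monotone
        (fun n => (measurable_const.sub (measurable_expNeg.comp (hφm n))).aemeasurable)
        (ae_of_all _ fun x m n hmn => ?_) (ae_of_all _ fun x => ?_)
      · exact tsub_le_tsub_left (expNeg_antitone (hφmono hmn x)) _
      · exact ENNReal.Tendsto.sub tendsto_const_nhds
          ((continuous_expNeg.tendsto _).comp (hφlim x)) (Or.inl ENNReal.one_ne_top)
    · refine ne_top_of_le_ne_top ENNReal.one_ne_top ?_
      calc _ ≤ ∫⁻ ω, 1 ∂Pr := lintegral_mono fun ω => by split_ifs <;> simp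
        _ = 1 := by simp

end IsPoissonPointProcess

end Poisson

/-! ### Squared distances in the plane -/

/-- The image of the area under `x ↦ ‖x‖ ^ 2` is `π` times Lebesgue measure on `[0, ∞)`. -/
lemma map_norm_sq_volume :
    (volume : Measure Plane).map (fun x => ‖x‖ ^ 2) =
      ENNReal.ofReal Real.pi • (volume : Measure ℝ).restrict (Ici 0) := by
  have hm : Measurable fun x : Plane => ‖x‖ ^ 2 := by fun_prop
  have : IsLocallyFiniteMeasure (ENNReal.ofReal Real.pi • (volume : Measure ℝ).restrict (Ici 0)) :=
    inferInstanceAs (IsLocallyFiniteMeasure (Real.pi.toNNReal • (volume : Measure ℝ).restrict (Ici 0)))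
  refine (Measure.ext_of_Ico _ _ fun a b hab => ?_).symm
  rw [Measure.map_apply hm measurableSet_Ico]
  -- This covers c ≤ 0 too: then the square root is 0 and both sets are empty.
  have hset : ∀ c : ℝ, {x : Plane | ‖x‖ ^ 2 < c} = Metric.ball 0 (Real.sqrt c) := by
    intro c
    ext x
    simp [Real.lt_sqrt (norm_nonneg x)]
  have hvol : ∀ c : ℝ, volume {x : Plane | ‖x‖ ^ 2 < c} =
      ENNReal.ofReal Real.pi * ENNReal.ofReal c := by
    intro c
    rw [hset, EuclideanSpace.volume_ball_fin_two, ← ENNReal.ofReal_pow (Real.sqrt_nonneg _), mul_comm]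
    rcases le_total 0 c with hc | hc
    · rw [Real.sq_sqrt hc]
    · rw [Real.sqrt_eq_zero_of_nonpos hc, ENNReal.ofReal_of_nonpos hc]; simp
  have hpre : (fun x : Plane => ‖x‖ ^ 2) ⁻¹' Ico a b =
      {x : Plane | ‖x‖ ^ 2 < b} \ {x : Plane | ‖x‖ ^ 2 < a} := by
    ext x; simp [and_comm]
  have hsub : {x : Plane | ‖x‖ ^ 2 < a} ⊆ {x : Plane | ‖x‖ ^ 2 < b} := fun x hx =>
    lt_trans (show ‖x‖ ^ 2 < a from hx) hab
  rw [hpre, measure_sdiff hsub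
    (hm measurableSet_Iio).nullMeasurableSet (by rw [hvol]; finiteness), hvol, hvol]
  have hI : Ico a b ∩ Ici 0 = Ico (max a 0) b := by
    ext x; simp only [mem_inter_iff, mem_Ico, mem_Ici, max_le_iff]; tauto
  rw [Measure.smul_apply, Measure.restrict_apply measurableSet_Ico, hI, Real.volume_Ico,
    smul_eq_mul, ← ENNReal.mul_sub (fun _ _ => ENNReal.ofReal_ne_top)]
  congr 1
  rcases le_total 0 a with ha | ha
  · rw [max_eq_left ha, ENNReal.ofReal_sub _ ha]
  · rw [max_eq_right ha, ENNReal.ofReal_of_nonpos ha]; simp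

/-- The reason for working with squared distances: for them the planar intensity `lam` becomes the
constant intensity `lam * π` on the half line. -/
lemma lintegral_norm_sq {F : ℝ → ℝ≥0∞} (hF : Measurable F) :
    ∫⁻ x : Plane, F (‖x‖ ^ 2) = ENNReal.ofReal Real.pi * ∫⁻ u in Ici 0, F u := by
  rw [← lintegral_map (f := F) (g := fun x : Plane => ‖x‖ ^ 2) hF (by fun_prop),
    map_norm_sq_volume, lintegral_smul_measure, smul_eq_mul]

/-- The ring of points whose squared norm lies in `[a, b)`. -/
def normSqRing (a b : ℝ) : Set Plane := {x | a ≤ ‖x‖ ^ 2 ∧ ‖x‖ ^ 2 < b}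

lemma measurableSet_normSqRing (a b : ℝ) : MeasurableSet (normSqRing a b) :=
  (show Measurable fun x : Plane => ‖x‖ ^ 2 by fun_prop) measurableSet_Ico

lemma volume_normSqRing {a b : ℝ} (ha : 0 ≤ a) :
    volume (normSqRing a b) = ENNReal.ofReal (Real.pi * (b - a)) := by
  have hm : Measurable fun x : Plane => ‖x‖ ^ 2 := by fun_prop
  have : volume (normSqRing a b) = volume.map (fun x : Plane => ‖x‖ ^ 2) (Ico a b) :=
    (Measure.map_apply hm measurableSet_Ico).symm
  rw [this, map_norm_sq_volume, Measure.smul_apply, Measure.restrict_apply measurableSet_Ico,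
    inter_eq_left.2 (show Ico a b ⊆ Ici 0 from fun x hx => ha.trans hx.1), Real.volume_Ico, smul_eq_mul,
    ENNReal.ofReal_mul Real.pi_pos.le]

/-! ### Dyadic cells of the half line -/

section Dyadic

/-- The left end of the dyadic interval of length `2 ^ (-n)` that contains `s`. -/
def dyadicLeft (n : ℕ) (s : ℝ) : ℝ := (⌊2 ^ n * s⌋₊ : ℝ) / 2 ^ n

/-- The right end of the dyadic interval of length `2 ^ (-n)` that contains `s`. -/
def dyadicRight (n : ℕ) (s : ℝ) : ℝ := ((⌊2 ^ n * s⌋₊ : ℝ) + 1) / 2 ^ n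

lemma dyadicLeft_nonneg (n : ℕ) (s : ℝ) : 0 ≤ dyadicLeft n s := by
  unfold dyadicLeft; positivity

lemma dyadicLeft_le (n : ℕ) {s : ℝ} (hs : 0 ≤ s) : dyadicLeft n s ≤ s := by
  rw [dyadicLeft, div_le_iff₀ (by positivity), mul_comm s]
  exact Nat.floor_le (by positivity)

lemma lt_dyadicRight (n : ℕ) (s : ℝ) : s < dyadicRight n s := by
  rw [dyadicRight, lt_div_iff₀ (by positivity), mul_comm s]
  exact Nat.lt_floor_add_one _

lemma dyadicRight_eq (n : ℕ) (s : ℝ) : dyadicRight n s = dyadicLeft n s + (1 / 2) ^ n := by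
  rw [dyadicRight, dyadicLeft, add_div, one_div_pow]

/-- A cell of level n + 1 is one half of a cell of level n. Hence the end points around `s` move
monotonically under refinement. -/
lemma floor_two_pow_succ_bounds (n : ℕ) {s : ℝ} (hs : 0 ≤ s) :
    2 * ⌊2 ^ n * s⌋₊ ≤ ⌊2 ^ (n + 1) * s⌋₊ ∧ ⌊2 ^ (n + 1) * s⌋₊ + 1 ≤ 2 * (⌊2 ^ n * s⌋₊ + 1) := by
  have h0 : (0 : ℝ) ≤ 2 ^ n * s := by positivity
  have h1 := Nat.floor_le h0
  have h2 := Nat.lt_floor_add_one (2 ^ n * s)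
  have e : (2 : ℝ) ^ (n + 1) * s = 2 * (2 ^ n * s) := by ring
  rw [e]
  constructor
  · refine Nat.le_floor ?_
    push_cast; linarith
  · refine (Nat.floor_lt (by positivity)).2 ?_
    push_cast; linarith

lemma monotone_dyadicLeft {s : ℝ} (hs : 0 ≤ s) : Monotone fun n => dyadicLeft n s := by
  refine monotone_nat_of_le_succ fun n => ?_
  have : (2 : ℝ) * ⌊2 ^ n * s⌋₊ ≤ ⌊2 ^ (n + 1) * s⌋₊ := by
    exact_mod_cast (floor_two_pow_succ_bounds n hs).1
  rw [dyadicLeft, dyadicLeft, div_le_div_iff₀ (by positivity) (by positivity), pow_succ 2 n]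
  rw [pow_succ] at this
  have : (0 : ℝ) < 2 ^ n := by positivity
  nlinarith

lemma antitone_dyadicRight {s : ℝ} (hs : 0 ≤ s) : Antitone fun n => dyadicRight n s := by
  refine antitone_nat_of_succ_le fun n => ?_
  have : (⌊2 ^ (n + 1) * s⌋₊ : ℝ) + 1 ≤ 2 * (⌊2 ^ n * s⌋₊ + 1) := by
    exact_mod_cast (floor_two_pow_succ_bounds n hs).2
  rw [dyadicRight, dyadicRight, div_le_div_iff₀ (by positivity) (by positivity), pow_succ 2 n]
  rw [pow_succ] at this
  have : (0 : ℝ) < 2 ^ n := by positivity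
  nlinarith

lemma tendsto_half_pow : Tendsto (fun n : ℕ => (1 / 2 : ℝ) ^ n) atTop (𝓝 0) :=
  tendsto_pow_atTop_nhds_zero_of_lt_one (by norm_num) (by norm_num)

lemma tendsto_dyadicLeft {s : ℝ} (hs : 0 ≤ s) :
    Tendsto (fun n => dyadicLeft n s) atTop (𝓝 s) := by
  refine tendsto_of_tendsto_of_tendsto_of_le_of_le (g := fun n : ℕ => s - (1 / 2) ^ n)
    (by simpa using tendsto_half_pow.const_sub s) tendsto_const_nhds (fun n => ?_)
    fun n => dyadicLeft_le n hs
  have := lt_dyadicRight n s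
  rw [dyadicRight_eq] at this
  simp only; linarith

lemma tendsto_dyadicRight {s : ℝ} (hs : 0 ≤ s) :
    Tendsto (fun n => dyadicRight n s) atTop (𝓝 s) := by
  simp_rw [dyadicRight_eq]
  simpa using (tendsto_dyadicLeft hs).add tendsto_half_pow

lemma floor_eq_iff_mem_dyadic (n k : ℕ) {s : ℝ} (hs : 0 ≤ s) :
    ⌊2 ^ n * s⌋₊ = k ↔ s ∈ Ico ((k : ℝ) / 2 ^ n) ((k + 1) / 2 ^ n) := by
  rw [Nat.floor_eq_iff (by positivity), mem_Ico, div_le_iff₀ (by positivity),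
    lt_div_iff₀ (by positivity), mul_comm s]

/-- Sums over cells become integrals of step functions, so that the refinement limit is a matter of
dominated convergence. -/
lemma lintegral_floor_two_pow (n : ℕ) (G : ℕ → ℝ≥0∞) :
    ∫⁻ v in Ici (0 : ℝ), G ⌊2 ^ n * v⌋₊ = ∑' k, ENNReal.ofReal ((1 / 2) ^ n) * G k := by
  have hU : Ici (0 : ℝ) = ⋃ k : ℕ, Ici 0 ∩ (fun v : ℝ => ⌊2 ^ n * v⌋₊) ⁻¹' {k} := by
    ext v; simp
  have hmf : Measurable fun v : ℝ => ⌊2 ^ n * v⌋₊ := Nat.measurable_floor.comp (by fun_prop)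
  have hm : ∀ k : ℕ, MeasurableSet (Ici 0 ∩ (fun v : ℝ => ⌊2 ^ n * v⌋₊) ⁻¹' {k}) := fun k =>
    measurableSet_Ici.inter (hmf (measurableSet_singleton k))
  rw [hU, lintegral_iUnion hm]
  · refine tsum_congr fun k => ?_
    rw [setLIntegral_congr_fun (hm k) (g := fun _ => G k)
      (fun v hv => by simp only [show ⌊2 ^ n * v⌋₊ = k from hv.2]), setLIntegral_const, mul_comm]
    congr 1
    have : Ici 0 ∩ (fun v : ℝ => ⌊2 ^ n * v⌋₊) ⁻¹' {k} =
        Ico ((k : ℝ) / 2 ^ n) ((k + 1) / 2 ^ n) := by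
      ext v
      constructor
      · rintro ⟨h0, h⟩
        exact (floor_eq_iff_mem_dyadic n k h0).1 h
      · intro h
        have h0 : 0 ≤ v := le_trans (by positivity) h.1
        exact ⟨h0, (floor_eq_iff_mem_dyadic n k h0).2 h⟩
    rw [this, Real.volume_Ico]
    congr 1
    rw [add_div, one_div_pow]; ring
  · intro i j hij
    refine Set.disjoint_left.2 fun v hv hv' => hij ?_
    exact hv.2.symm.trans hv'.2

end Dyadic

/-! ### The first occupied cell -/

section Poisson

variable {Ω : Type*} [MeasurableSpace Ω] {Pr : Measure Ω} [IsProbabilityMeasure Pr] {lam : ℝ}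
  {X : ℕ → Ω → Plane}

/-- No point has squared norm less than `a`, and exactly one has squared norm in `[a, b)`. -/
def FirstIn (X : ℕ → Ω → Plane) (a b : ℝ) (ω : Ω) : Prop :=
  (∀ i, a ≤ ‖X i ω‖ ^ 2) ∧ pointCount X (normSqRing a b) ω = 1

lemma measurableSet_firstIn (hX : ∀ i, Measurable (X i)) (a b : ℝ) :
    MeasurableSet {ω | FirstIn X a b ω} := by
  have h1 : MeasurableSet {ω | ∀ i, a ≤ ‖X i ω‖ ^ 2} := by
    rw [ofPred_forall]
    exact MeasurableSet.iInter fun i => measurableSet_le measurable_const ((hX i).norm.pow_const 2)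
  exact h1.inter (measurable_pointCount hX (measurableSet_normSqRing a b) (measurableSet_singleton 1))

open Classical in
-- The three factors are the mean number of points in the ring, the probability that the disc of
-- squared radius `b` has no further point, and the Laplace functional outside that disc.
lemma IsPoissonPointProcess.lintegral_firstIn (h : IsPoissonPointProcess Pr lam X)
    (hlam : 0 ≤ lam) {a b : ℝ} (ha : 0 ≤ a) (hab : a ≤ b) {φ : ℝ → ℝ≥0∞} (hφ : Measurable φ) :
    ∫⁻ ω, (if FirstIn X a b ω then 1 else 0) *
        expNeg (∑' i, if b ≤ ‖X i ω‖ ^ 2 then φ (‖X i ω‖ ^ 2) else 0) ∂Pr =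
      ENNReal.ofReal (lam * Real.pi * (b - a)) * ENNReal.ofReal (Real.exp (-(lam * Real.pi * b))) *
        expNeg (ENNReal.ofReal (lam * Real.pi) * ∫⁻ u in Ici b, 1 - expNeg (φ u)) := by
  -- The value ∞ below `a` encodes the absence of points there, because exp(-∞) = 0. The value 0 on
  -- [a, b) leaves the single point of the ring out of the shot noise.
  let F : ℝ → ℝ≥0∞ := fun u => if u < a then ∞ else if u < b then 0 else φ u
  have hF : Measurable F := Measurable.ite measurableSet_Iio measurable_const
    (Measurable.ite measurableSet_Iio measurable_const hφ)
  have hv := volume_normSqRing (b := b) ha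
  have key := h.lintegral_one_point_mul_expNeg hlam (measurableSet_normSqRing a b)
    (by rw [hv]; finiteness) (f := fun x => F (‖x‖ ^ 2)) (hF.comp (by fun_prop))
    (fun x hx => by simp [F, not_lt.2 hx.1, hx.2])
  rw [h.lintegral_pointCount_eq_one hlam (measurableSet_normSqRing a b) (by rw [hv]; finiteness),
    measureReal_def, hv, ENNReal.toReal_ofReal (mul_nonneg Real.pi_pos.le (by linarith)),
    lintegral_norm_sq (F := fun u => 1 - expNeg (F u))
      (measurable_const.sub (measurable_expNeg.comp hF))] at key
  have hint : ∫⁻ u in Ici 0, 1 - expNeg (F u) =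
      ENNReal.ofReal a + ∫⁻ u in Ici b, 1 - expNeg (φ u) := by
    have hIci : Ici (0 : ℝ) = Ico 0 a ∪ Ico a b ∪ Ici b := by
      rw [Ico_union_Ico_eq_Ico ha hab, Ico_union_Ici_eq_Ici (ha.trans hab)]
    rw [hIci, lintegral_union measurableSet_Ici, lintegral_union measurableSet_Ico]
    · rw [setLIntegral_congr_fun measurableSet_Ico (g := fun _ => 1)
        (fun u hu => by simp [F, hu.2]),
        setLIntegral_congr_fun (s := Ico a b) measurableSet_Ico (g := fun _ => 0)
        (fun u hu => by simp [F, hu.2, not_lt.2 hu.1]),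
        setLIntegral_congr_fun (s := Ici b) measurableSet_Ici (g := fun u => 1 - expNeg (φ u))
        (fun u (hu : b ≤ u) => by simp [F, not_lt.2 hu, not_lt.2 (hab.trans hu)])]
      simp
    · exact Set.disjoint_left.2 fun u hu hu' => (hu'.1.not_gt hu.2)
    · refine Set.disjoint_left.2 fun u hu (hu' : b ≤ u) => ?_
      rcases hu with hu | hu
      · exact (hab.trans hu').not_gt hu.2
      · exact hu'.not_gt hu.2
  rw [hint] at key
  have hL : ∀ ω, (if FirstIn X a b ω then 1 else 0) *
        expNeg (∑' i, if b ≤ ‖X i ω‖ ^ 2 then φ (‖X i ω‖ ^ 2) else 0) =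
      (if pointCount X (normSqRing a b) ω = 1 then 1 else 0) * expNeg (∑' i, F (‖X i ω‖ ^ 2)) := by
    intro ω
    by_cases h1 : ∀ i, a ≤ ‖X i ω‖ ^ 2
    · have : ∀ i, F (‖X i ω‖ ^ 2) = if b ≤ ‖X i ω‖ ^ 2 then φ (‖X i ω‖ ^ 2) else 0 := by
        intro i
        simp only [F, if_neg (not_lt.2 (h1 i))]
        by_cases hb : b ≤ ‖X i ω‖ ^ 2
        · rw [if_neg (not_lt.2 hb), if_pos hb]
        · rw [if_pos (not_le.1 hb), if_neg hb]
      simp_rw [this]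
      simp [FirstIn, h1]
    · have h2 : ¬ FirstIn X a b ω := fun h => h1 h.1
      push Not at h1
      obtain ⟨i, hi⟩ := h1
      have : ∑' i, F (‖X i ω‖ ^ 2) = ∞ := ENNReal.tsum_eq_top_of_eq_top ⟨i, by simp [F, hi]⟩
      rw [this, if_neg h2]; simp
  rw [lintegral_congr hL, key, mul_add, mul_add, expNeg_add,
    ← ENNReal.ofReal_mul Real.pi_pos.le, ← ENNReal.ofReal_mul hlam,
    expNeg_ofReal (by have := Real.pi_pos; positivity), ← mul_assoc, ← mul_assoc (ENNReal.ofReal lam),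
    ← ENNReal.ofReal_mul hlam, ← ENNReal.ofReal_mul (by
      have := Real.pi_pos
      have := sub_nonneg.2 hab
      positivity), ← ENNReal.ofReal_mul (by
      have := Real.pi_pos
      have := sub_nonneg.2 hab
      positivity)]
  congr 2
  have : Real.exp (-(lam * Real.pi * b)) =
      Real.exp (-(lam * (Real.pi * (b - a)))) * Real.exp (-(lam * (Real.pi * a))) := by
    rw [← Real.exp_add]; congr 1; ring
  rw [this]; ring

/-- The dyadic cell of squared norms that contains point `y` separates it from all other points. -/
def DyadicFirst (X : ℕ → Ω → Plane) (n : ℕ) (ω : Ω) (y : ℕ) : Prop :=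
  ∀ i, i ≠ y → dyadicRight n (‖X y ω‖ ^ 2) ≤ ‖X i ω‖ ^ 2

omit [MeasurableSpace Ω] in
lemma DyadicFirst.mono {n m : ℕ} (hnm : n ≤ m) {ω : Ω} {y : ℕ} (h : DyadicFirst X n ω y) :
    DyadicFirst X m ω y := fun i hi => (antitone_dyadicRight (sq_nonneg _) hnm).trans (h i hi)

omit [MeasurableSpace Ω] in
lemma DyadicFirst.norm_lt {n : ℕ} {ω : Ω} {y : ℕ} (h : DyadicFirst X n ω y) {i : ℕ} (hi : i ≠ y) :
    ‖X y ω‖ < ‖X i ω‖ :=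
  lt_of_pow_lt_pow_left₀ 2 (norm_nonneg _) ((lt_dyadicRight n _).trans_le (h i hi))

omit [MeasurableSpace Ω] in
lemma DyadicFirst.isClosest_iff {n : ℕ} {ω : Ω} {y : ℕ} (h : DyadicFirst X n ω y) (i : ℕ) :
    IsClosest X ω i ↔ i = y := by
  constructor
  · intro hi
    by_contra hne
    exact (hi y).not_gt (h.norm_lt hne)
  · rintro rfl j
    rcases eq_or_ne j i with rfl | hj
    exacts [le_rfl, (h.norm_lt hj).le]

omit [MeasurableSpace Ω] in
lemma DyadicFirst.serving_eq {n : ℕ} {ω : Ω} {y : ℕ} (h : DyadicFirst X n ω y) :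
    serving X ω = y := by
  simp [serving, h.isClosest_iff]

omit [MeasurableSpace Ω] in
-- Translates between counts, whose joint law is known, and the index of the closest point, which
-- the SINR refers to.
lemma firstIn_dyadic_iff (n k : ℕ) (ω : Ω) :
    FirstIn X (k / 2 ^ n) ((k + 1) / 2 ^ n) ω ↔
      ∃ y, DyadicFirst X n ω y ∧ ⌊2 ^ n * ‖X y ω‖ ^ 2⌋₊ = k := by
  constructor
  · rintro ⟨h0, h1⟩
    obtain ⟨y, hy⟩ := Set.encard_eq_one.1 h1
    have hy' : X y ω ∈ normSqRing (k / 2 ^ n) ((k + 1) / 2 ^ n) := by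
      have : y ∈ {i | X i ω ∈ normSqRing (k / 2 ^ n) ((k + 1) / 2 ^ n)} := hy ▸ rfl
      exact this
    have hk := (floor_eq_iff_mem_dyadic n k (sq_nonneg ‖X y ω‖)).2 hy'
    refine ⟨y, fun i hi => ?_, hk⟩
    rw [dyadicRight, hk]
    by_contra hlt
    have : i ∈ {i | X i ω ∈ normSqRing (k / 2 ^ n) ((k + 1) / 2 ^ n)} := ⟨h0 i, not_le.1 hlt⟩
    rw [hy] at this
    exact hi this
  · rintro ⟨y, hy, hk⟩
    have hmem := (floor_eq_iff_mem_dyadic n k (sq_nonneg ‖X y ω‖)).1 hk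
    have hR : dyadicRight n (‖X y ω‖ ^ 2) = (k + 1) / 2 ^ n := by rw [dyadicRight, hk]
    refine ⟨fun i => ?_, ?_⟩
    · rcases eq_or_ne i y with rfl | hi
      · exact hmem.1
      · exact hmem.1.trans (by gcongr; exact (hy.norm_lt hi).le)
    · refine Set.encard_eq_one.2 ⟨y, ?_⟩
      ext i
      constructor
      · intro hi
        by_contra hne
        have := hy i hne
        rw [hR] at this
        exact this.not_gt hi.2
      · rintro rfl
        exact hmem

end Poisson

/-! ### The process seen from its closest point -/

section Poisson

variable {Ω : Type*} [MeasurableSpace Ω] {Pr : Measure Ω} [IsProbabilityMeasure Pr] {lam : ℝ}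
  {X : ℕ → Ω → Plane}

open Classical in
/-- Dyadic approximation of `exp (-A S_y - ∑_{i ≠ y} ℓ (S_y) (S_i))`, where `S_i` is the squared
norm of point `i` and `y` is the closest point. -/
def dyadicServingFunctional (X : ℕ → Ω → Plane) (A : ℝ → ℝ≥0∞) (ℓ : ℝ → ℝ → ℝ≥0∞) (n : ℕ) (ω : Ω) :
    ℝ≥0∞ :=
  ∑' k : ℕ, (if FirstIn X (k / 2 ^ n) ((k + 1) / 2 ^ n) ω then 1 else 0) *
    expNeg (∑' i, if (k + 1) / 2 ^ n ≤ ‖X i ω‖ ^ 2 then ℓ (k / 2 ^ n) (‖X i ω‖ ^ 2) else 0) *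
      expNeg (A (k / 2 ^ n))

lemma measurable_dyadicServingFunctional (hX : ∀ i, Measurable (X i)) (A : ℝ → ℝ≥0∞)
    {ℓ : ℝ → ℝ → ℝ≥0∞} (hℓ : ∀ s, Measurable (ℓ s)) (n : ℕ) :
    Measurable (dyadicServingFunctional X A ℓ n) := by
  refine Measurable.tsum fun k => Measurable.mul_const (Measurable.mul ?_ ?_) _
  · exact Measurable.ite (measurableSet_firstIn hX _ _) measurable_const measurable_const
  · refine measurable_expNeg.comp (Measurable.tsum fun i => Measurable.ite ?_ ?_ measurable_const)
    · exact measurableSet_le measurable_const ((hX i).norm.pow_const 2)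
    · exact (hℓ _).comp ((hX i).norm.pow_const 2)

omit [MeasurableSpace Ω] in
-- Only the cell containing the separated point `y` contributes to the sum over cells. Since all
-- other points lie beyond its right end, the restriction in the shot noise removes exactly `y`.
lemma dyadicServingFunctional_of_dyadicFirst (A : ℝ → ℝ≥0∞) (ℓ : ℝ → ℝ → ℝ≥0∞) {n : ℕ} {ω : Ω}
    {y : ℕ} (h : DyadicFirst X n ω y) :
    dyadicServingFunctional X A ℓ n ω =
      expNeg (A (dyadicLeft n (‖X y ω‖ ^ 2)) +
        ∑' i, if i = y then 0 else ℓ (dyadicLeft n (‖X y ω‖ ^ 2)) (‖X i ω‖ ^ 2)) := by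
  classical
  have hfirst : ∀ k : ℕ, FirstIn X (k / 2 ^ n) ((k + 1) / 2 ^ n) ω ↔
      ⌊2 ^ n * ‖X y ω‖ ^ 2⌋₊ = k := by
    intro k
    rw [firstIn_dyadic_iff]
    constructor
    · rintro ⟨z, hz, hk⟩
      rwa [show y = z from h.serving_eq.symm.trans hz.serving_eq]
    · exact fun hk => ⟨y, h, hk⟩
  rw [dyadicServingFunctional, tsum_eq_single ⌊2 ^ n * ‖X y ω‖ ^ 2⌋₊]
  · rw [if_pos ((hfirst _).2 rfl), one_mul, ← expNeg_add, add_comm]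
    congr 2
    refine tsum_congr fun i => ?_
    by_cases hi : i = y
    · subst hi
      have := not_le.2 (lt_dyadicRight n (‖X i ω‖ ^ 2))
      rw [dyadicRight] at this
      rw [if_pos rfl, if_neg this]
    · have := h i hi
      rw [dyadicRight] at this
      rw [if_neg hi, if_pos this, dyadicLeft]
  · intro k hk
    rw [if_neg (fun h' => hk ((hfirst k).1 h').symm)]
    simp

omit [MeasurableSpace Ω] in
lemma dyadicServingFunctional_of_forall_not (A : ℝ → ℝ≥0∞) (ℓ : ℝ → ℝ → ℝ≥0∞) {n : ℕ} {ω : Ω}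
    (h : ∀ y, ¬ DyadicFirst X n ω y) : dyadicServingFunctional X A ℓ n ω = 0 := by
  classical
  rw [dyadicServingFunctional, ENNReal.tsum_eq_zero]
  intro k
  rw [if_neg fun h' => by
    obtain ⟨y, hy, -⟩ := (firstIn_dyadic_iff n k ω).1 h'
    exact h y hy]
  simp

omit [MeasurableSpace Ω] in
lemma dyadicServingFunctional_le_one (A : ℝ → ℝ≥0∞) (ℓ : ℝ → ℝ → ℝ≥0∞) (n : ℕ) (ω : Ω) :
    dyadicServingFunctional X A ℓ n ω ≤ 1 := by
  by_cases h : ∃ y, DyadicFirst X n ω y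
  · obtain ⟨y, hy⟩ := h
    rw [dyadicServingFunctional_of_dyadicFirst A ℓ hy]
    exact expNeg_le_one _
  · push Not at h
    rw [dyadicServingFunctional_of_forall_not A ℓ h]
    exact zero_le

lemma IsPoissonPointProcess.lintegral_dyadicServingFunctional
    (h : IsPoissonPointProcess Pr lam X) (hlam : 0 ≤ lam) (A : ℝ → ℝ≥0∞) {ℓ : ℝ → ℝ → ℝ≥0∞}
    (hℓ : ∀ s, Measurable (ℓ s)) (n : ℕ) :
    ∫⁻ ω, dyadicServingFunctional X A ℓ n ω ∂Pr =
      ∫⁻ v in Ici (0 : ℝ), ENNReal.ofReal (lam * Real.pi) *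
        ENNReal.ofReal (Real.exp (-(lam * Real.pi * dyadicRight n v))) *
        expNeg (ENNReal.ofReal (lam * Real.pi) *
          ∫⁻ u in Ici (dyadicRight n v), 1 - expNeg (ℓ (dyadicLeft n v) u)) *
        expNeg (A (dyadicLeft n v)) := by
  classical
  have hpi := Real.pi_pos
  have hm := h.measurable_point
  have hmeas : ∀ k : ℕ, Measurable fun ω =>
      (if FirstIn X (k / 2 ^ n) ((k + 1) / 2 ^ n) ω then (1 : ℝ≥0∞) else 0) *
    expNeg (∑' i, if (k + 1) / 2 ^ n ≤ ‖X i ω‖ ^ 2 then ℓ (k / 2 ^ n) (‖X i ω‖ ^ 2) else 0) := by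
    intro k
    refine Measurable.mul ?_ ?_
    · exact Measurable.ite (measurableSet_firstIn hm _ _) measurable_const measurable_const
    · refine measurable_expNeg.comp (Measurable.tsum fun i => Measurable.ite ?_ ?_ measurable_const)
      · exact measurableSet_le measurable_const ((hm i).norm.pow_const 2)
      · exact (hℓ _).comp ((hm i).norm.pow_const 2)
  have hR := lintegral_floor_two_pow n fun k => ENNReal.ofReal (lam * Real.pi) *
        ENNReal.ofReal (Real.exp (-(lam * Real.pi * ((k + 1) / 2 ^ n)))) *
        expNeg (ENNReal.ofReal (lam * Real.pi) *
          ∫⁻ u in Ici (((k : ℝ) + 1) / 2 ^ n), 1 - expNeg (ℓ (k / 2 ^ n) u)) *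
        expNeg (A (k / 2 ^ n))
  simp only [dyadicRight, dyadicLeft, hR, dyadicServingFunctional]
  rw [lintegral_tsum fun k => ((hmeas k).mul_const _).aemeasurable]
  refine tsum_congr fun k => ?_
  rw [lintegral_mul_const _ (hmeas k), h.lintegral_firstIn hlam (by positivity) (by gcongr; linarith)
    (hℓ _)]
  -- The ring probability contains the cell width, which is the weight that turns the sum into an
  -- integral.
  have : lam * Real.pi * ((k + 1) / 2 ^ n - k / 2 ^ n) = (1 / 2) ^ n * (lam * Real.pi) := by
    rw [add_div, one_div_pow]; ring
  rw [this, ENNReal.ofReal_mul (by positivity)]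
  ring

/-- The expectations of the dyadic approximations converge to the integral against the law of the
squared distance of the closest point. -/
lemma IsPoissonPointProcess.tendsto_lintegral_dyadicServingFunctional
    (h : IsPoissonPointProcess Pr lam X) (hlam : 0 < lam) {A : ℝ → ℝ≥0∞} {ℓ : ℝ → ℝ → ℝ≥0∞}
    (hA : Continuous A) (hℓ : ∀ s, Measurable (ℓ s)) {ρ : ℝ}
    (hJ : ∀ s, 0 ≤ s → ∫⁻ u in Ici s, 1 - expNeg (ℓ s u) = ENNReal.ofReal (s * ρ)) :
    Tendsto (fun n => ∫⁻ ω, dyadicServingFunctional X A ℓ n ω ∂Pr) atTop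
      (𝓝 (∫⁻ v in Ici (0 : ℝ), ENNReal.ofReal (lam * Real.pi) *
        ENNReal.ofReal (Real.exp (-(lam * Real.pi * v))) *
        expNeg (ENNReal.ofReal (lam * Real.pi) * ENNReal.ofReal (v * ρ)) * expNeg (A v))) := by
  have hpi := Real.pi_pos
  simp_rw [h.lintegral_dyadicServingFunctional hlam.le A hℓ]
  refine tendsto_lintegral_of_dominated_convergence
    (fun v => ENNReal.ofReal (lam * Real.pi) * ENNReal.ofReal (Real.exp (-(lam * Real.pi * v))))
    (fun n => ?_) (fun n => ?_) ?_ ?_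
  · have hmf : Measurable fun v : ℝ => ⌊2 ^ n * v⌋₊ := Nat.measurable_floor.comp (by fun_prop)
    exact (measurable_from_top (f := fun k : ℕ => ENNReal.ofReal (lam * Real.pi) *
        ENNReal.ofReal (Real.exp (-(lam * Real.pi * ((k + 1) / 2 ^ n)))) *
        expNeg (ENNReal.ofReal (lam * Real.pi) *
          ∫⁻ u in Ici (((k : ℝ) + 1) / 2 ^ n), 1 - expNeg (ℓ (k / 2 ^ n) u)) *
        expNeg (A (k / 2 ^ n)))).comp hmf
  · refine ae_of_all _ fun v => ?_
    refine (mul_le_of_le_one_right' (expNeg_le_one _)).trans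
      ((mul_le_of_le_one_right' (expNeg_le_one _)).trans ?_)
    dsimp only
    gcongr
    exact (lt_dyadicRight n v).le
  · have hint : IntegrableOn (fun v : ℝ => Real.exp (-(lam * Real.pi) * v)) (Ici 0) := by
      rw [integrableOn_Ici_iff_integrableOn_Ioi]
      exact integrableOn_exp_mul_Ioi (by simp; positivity) 0
    rw [lintegral_const_mul _ (by fun_prop)]
    refine ENNReal.mul_ne_top ENNReal.ofReal_ne_top ?_
    simp_rw [← neg_mul (lam * Real.pi)]
    exact hint.lintegral_lt_top.ne
  · filter_upwards [ae_restrict_mem measurableSet_Ici] with v hv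
    have hv : 0 ≤ v := hv
    have hl := tendsto_dyadicLeft hv
    have hr := tendsto_dyadicRight hv
    have hbdd : ∀ x, expNeg x ≠ ∞ := fun x => ne_top_of_le_ne_top ENNReal.one_ne_top (expNeg_le_one x)
    refine ENNReal.Tendsto.mul (ENNReal.Tendsto.mul (ENNReal.Tendsto.const_mul ?_
      (Or.inr ENNReal.ofReal_ne_top)) (Or.inr (hbdd _)) ?_
      (Or.inr (ENNReal.mul_ne_top ENNReal.ofReal_ne_top ENNReal.ofReal_ne_top)))
      (Or.inr (hbdd _)) ?_ (Or.inr ?_)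
    · refine ENNReal.tendsto_ofReal ?_
      exact (Real.continuous_exp.tendsto _).comp ((hr.const_mul _).neg)
    · refine (continuous_expNeg.tendsto _).comp
        (ENNReal.Tendsto.const_mul ?_ (Or.inr ENNReal.ofReal_ne_top))
      -- The value of the integral is known when it starts at the left end of the cell, but here it
      -- starts at the right end. The integrand is at most 1, so the gap costs at most the cell
      -- width.
      have hlow : Tendsto (fun n => ENNReal.ofReal (dyadicLeft n v * ρ) -
          ENNReal.ofReal ((1 / 2) ^ n)) atTop (𝓝 (ENNReal.ofReal (v * ρ))) := by
        have := ENNReal.Tendsto.sub (ENNReal.tendsto_ofReal (hl.mul_const ρ))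
          (ENNReal.tendsto_ofReal tendsto_half_pow) (Or.inl ENNReal.ofReal_ne_top)
        simpa using this
      refine tendsto_of_tendsto_of_tendsto_of_le_of_le hlow
        (ENNReal.tendsto_ofReal (hl.mul_const ρ)) (fun n => ?_) fun n => ?_
      · simp only
        rw [← hJ _ (dyadicLeft_nonneg n v), tsub_le_iff_right,
          ← Ico_union_Ici_eq_Ici (a := dyadicLeft n v) (b := dyadicRight n v)
            (by rw [dyadicRight_eq]; linarith [show (0:ℝ) ≤ (1 / 2) ^ n by positivity])]
        refine (lintegral_union_le _ _ _).trans ?_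
        rw [add_comm]
        gcongr
        calc ∫⁻ u in Ico (dyadicLeft n v) (dyadicRight n v), 1 - expNeg (ℓ (dyadicLeft n v) u)
            ≤ ∫⁻ u in Ico (dyadicLeft n v) (dyadicRight n v), 1 :=
              lintegral_mono fun u => tsub_le_self
          _ = ENNReal.ofReal ((1 / 2) ^ n) := by
              rw [setLIntegral_one, Real.volume_Ico, dyadicRight_eq]; simp
      · simp only
        rw [← hJ _ (dyadicLeft_nonneg n v)]
        refine lintegral_mono_set (Ici_subset_Ici.2 ?_)
        rw [dyadicRight_eq]; linarith [show (0:ℝ) ≤ (1 / 2) ^ n by positivity]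
    · exact (continuous_expNeg.tendsto _).comp ((hA.tendsto _).comp hl)
    · exact ENNReal.mul_ne_top (ENNReal.mul_ne_top ENNReal.ofReal_ne_top ENNReal.ofReal_ne_top)
        (hbdd _)

lemma lintegral_exp_neg_mul_Ici {b : ℝ} (hb : 0 < b) :
    ∫⁻ v in Ici (0 : ℝ), ENNReal.ofReal b * ENNReal.ofReal (Real.exp (-(b * v))) = 1 := by
  have hint : IntegrableOn (fun v : ℝ => Real.exp (-b * v)) (Ici 0) := by
    rw [integrableOn_Ici_iff_integrableOn_Ioi]
    exact integrableOn_exp_mul_Ioi (by simpa using hb) 0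
  rw [lintegral_const_mul _ (by fun_prop)]
  simp_rw [← neg_mul]
  rw [← ofReal_integral_eq_lintegral_ofReal hint (ae_of_all _ fun _ => (Real.exp_pos _).le),
    integral_Ici_eq_integral_Ioi, integral_exp_mul_Ioi (by simpa using hb), ← ENNReal.ofReal_mul hb.le]
  simp [hb.ne']

/-- Almost surely, some dyadic cell separates one point from all the others, which lie further
away. -/
lemma IsPoissonPointProcess.ae_exists_dyadicFirst (h : IsPoissonPointProcess Pr lam X)
    (hlam : 0 < lam) : ∀ᵐ ω ∂Pr, ∃ n y, DyadicFirst X n ω y := by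
  -- With zero exponents the functional is the indicator that level n separates a first point, and
  -- its expectation tends to the total mass 1 of an exponential law.
  have key := h.tendsto_lintegral_dyadicServingFunctional hlam (A := 0) (ℓ := 0)
    continuous_const (ρ := 0) (fun _ => measurable_const) (by simp)
  simp only [mul_zero, ENNReal.ofReal_zero, expNeg_zero, mul_one, Pi.zero_apply,
    lintegral_exp_neg_mul_Ici (mul_pos hlam Real.pi_pos)] at key
  let D : Set Ω := ⋃ n, {ω | dyadicServingFunctional X 0 0 n ω ≠ 0}
  have hmeas : ∀ n, Measurable (dyadicServingFunctional X 0 0 n) := fun n =>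
    measurable_dyadicServingFunctional h.measurable_point 0 (fun _ => measurable_const) n
  have hD : MeasurableSet D := MeasurableSet.iUnion fun n =>
    (hmeas n) (measurableSet_singleton 0).compl
  have hle : ∀ n, ∫⁻ ω, dyadicServingFunctional X 0 0 n ω ∂Pr ≤ Pr D := by
    intro n
    rw [← lintegral_indicator_one hD]
    refine lintegral_mono fun ω => ?_
    by_cases hω : dyadicServingFunctional X 0 0 n ω = 0
    · rw [hω]; exact zero_le
    · have : ω ∈ D := mem_iUnion.2 ⟨n, hω⟩
      simpa [this] using dyadicServingFunctional_le_one 0 0 n ω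
  have h1 : 1 ≤ Pr D := le_of_tendsto' key hle
  have hD1 : Pr Dᶜ = 0 := by
    rw [prob_compl_eq_zero_iff hD]
    exact le_antisymm prob_le_one h1
  filter_upwards [measure_eq_zero_iff_ae_notMem.1 hD1] with ω hω
  simp only [mem_compl_iff, not_not] at hω
  obtain ⟨n, hn⟩ := mem_iUnion.1 hω
  by_contra hcon
  push Not at hcon
  exact hn (dyadicServingFunctional_of_forall_not 0 0 (hcon n))

/-- Laplace functional of a Poisson process as seen from its closest point: `s` is the squared
distance of the closest point, the other points form a Poisson process outside the disc. -/
theorem IsPoissonPointProcess.lintegral_serving (h : IsPoissonPointProcess Pr lam X)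
    (hlam : 0 < lam) {A : ℝ → ℝ≥0∞} {ℓ : ℝ → ℝ → ℝ≥0∞}
    (hA : Continuous A) (hℓ : ∀ s, Measurable (ℓ s)) (hℓm : ∀ u, 0 ≤ u → MonotoneOn (ℓ · u) (Ici 0))
    (hℓc : ∀ u, 0 ≤ u → Continuous (ℓ · u)) {ρ : ℝ}
    (hJ : ∀ s, 0 ≤ s → ∫⁻ u in Ici s, 1 - expNeg (ℓ s u) = ENNReal.ofReal (s * ρ)) :
    ∫⁻ ω, expNeg (A (‖X (serving X ω) ω‖ ^ 2) +
        ∑' i, if i = serving X ω then 0 else ℓ (‖X (serving X ω) ω‖ ^ 2) (‖X i ω‖ ^ 2)) ∂Pr =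
      ∫⁻ v in Ici (0 : ℝ), ENNReal.ofReal (lam * Real.pi) *
        ENNReal.ofReal (Real.exp (-(lam * Real.pi * v))) *
        expNeg (ENNReal.ofReal (lam * Real.pi) * ENNReal.ofReal (v * ρ)) * expNeg (A v) := by
  refine tendsto_nhds_unique (tendsto_lintegral_of_dominated_convergence (fun _ => 1)
    (fun n => measurable_dyadicServingFunctional h.measurable_point A hℓ n)
    (fun n => ae_of_all _ fun ω => dyadicServingFunctional_le_one A ℓ n ω) (by simp) ?_)
    (h.tendsto_lintegral_dyadicServingFunctional hlam hA hℓ hJ)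
  filter_upwards [h.ae_exists_dyadicFirst hlam] with ω ⟨N, y, hy⟩
  rw [hy.serving_eq]
  have hs := sq_nonneg ‖X y ω‖
  -- The left end points increase to the squared distance of `y`, and `ℓ` is monotone in it.
  -- Monotone convergence therefore passes under the sum, whether or not it is finite.
  have hlim : Tendsto (fun n => expNeg (A (dyadicLeft n (‖X y ω‖ ^ 2)) +
        ∑' i, if i = y then 0 else ℓ (dyadicLeft n (‖X y ω‖ ^ 2)) (‖X i ω‖ ^ 2))) atTop
      (𝓝 (expNeg (A (‖X y ω‖ ^ 2) + ∑' i, if i = y then 0 else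
        ℓ (‖X y ω‖ ^ 2) (‖X i ω‖ ^ 2)))) := by
    refine (continuous_expNeg.tendsto _).comp
      (((hA.tendsto _).comp (tendsto_dyadicLeft hs)).add ?_)
    simp_rw [← lintegral_count]
    refine lintegral_tendsto_of_tendsto_of_monotone (fun n => measurable_from_top.aemeasurable)
      (ae_of_all _ fun i m n hmn => ?_) (ae_of_all _ fun i => ?_)
    · by_cases hi : i = y
      · simp [hi]
      · simp only [hi, if_false]
        exact hℓm _ (sq_nonneg _) (dyadicLeft_nonneg m _) (dyadicLeft_nonneg n _)
          (monotone_dyadicLeft hs hmn)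
    · by_cases hi : i = y
      · simp [hi]
      · simp only [hi, if_false]
        exact ((hℓc _ (sq_nonneg _)).tendsto _).comp (tendsto_dyadicLeft hs)
  refine hlim.congr' ?_
  filter_upwards [eventually_ge_atTop N] with n hn
  exact (dyadicServingFunctional_of_dyadicFirst A ℓ (hy.mono hn)).symm

end Poisson

/-! ### Tail and Laplace transform of the exponential law -/

section Exponential

variable {μ : ℝ}

lemma expMeasure_lt_ofReal (hμ : 0 < μ) (w : ℝ≥0∞) :
    expMeasure μ {x | w < ENNReal.ofReal x} = expNeg (ENNReal.ofReal μ * w) := by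
  have := isProbabilityMeasure_expMeasure hμ
  induction w using ENNReal.recTopCoe with
  | top => simp [ENNReal.mul_top, hμ]
  | coe r =>
    have hset : {x : ℝ | (r : ℝ≥0∞) < ENNReal.ofReal x} = (Iic (r : ℝ))ᶜ := by
      ext x
      rw [mem_ofPred_eq, ← ENNReal.ofReal_coe_nnreal,
        ENNReal.ofReal_lt_ofReal_iff_of_nonneg NNReal.zero_le_coe]
      simp
    have hexp : Real.exp (-(μ * r)) ≤ 1 := Real.exp_le_one_iff.2 (by simp; positivity)
    rw [hset, prob_compl_eq_one_sub measurableSet_Iic, ← ofReal_cdf, cdf_expMeasure_eq hμ,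
      if_pos NNReal.zero_le_coe, ← ENNReal.ofReal_one, ← ENNReal.ofReal_sub _ (by linarith),
      ← ENNReal.ofReal_coe_nnreal (p := r), ← ENNReal.ofReal_mul hμ.le,
      expNeg_ofReal (by positivity)]
    congr 1; ring

/-- The Laplace transform is 1/(1 + a). Writing it as exp(-log(1 + a)) lets products over stations
become sums of exponents, the form required by the Poisson Laplace functional. -/
lemma lintegral_expNeg_expMeasure (hμ : 0 < μ) {a : ℝ} (ha : 0 ≤ a) :
    ∫⁻ x, expNeg (ENNReal.ofReal μ * (ENNReal.ofReal a * ENNReal.ofReal x)) ∂(expMeasure μ) =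
      expNeg (ENNReal.ofReal (Real.log (1 + a))) := by
  have hm : Measurable fun x =>
      expNeg (ENNReal.ofReal μ * (ENNReal.ofReal a * ENNReal.ofReal x)) :=
    measurable_expNeg.comp (by fun_prop)
  have hpos : (0 : ℝ) < 1 + a := by linarith
  have hpdf : expMeasure μ = volume.withDensity (exponentialPDF μ) := rfl
  have hpm : Measurable (exponentialPDF μ) := (measurable_exponentialPDFReal μ).ennreal_ofReal
  rw [hpdf, lintegral_withDensity_eq_lintegral_mul _ hpm hm,
    expNeg_ofReal (Real.log_nonneg (by linarith)), Real.exp_neg, Real.exp_log hpos]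
  -- The integrand is 1/(1 + a) times the exponential density of rate μ(1 + a).
  have hfun : (fun x => (exponentialPDF μ * fun x =>
      expNeg (ENNReal.ofReal μ * (ENNReal.ofReal a * ENNReal.ofReal x))) x) =
      (Ici 0).indicator fun x => ENNReal.ofReal (1 + a)⁻¹ * (ENNReal.ofReal (μ * (1 + a)) *
        ENNReal.ofReal (Real.exp (-(μ * (1 + a) * x)))) := by
    ext x
    by_cases hx : 0 ≤ x
    · rw [indicator_of_mem (show x ∈ Ici 0 from hx), Pi.mul_apply, exponentialPDF_of_nonneg hx,
        ← ENNReal.ofReal_mul ha, ← ENNReal.ofReal_mul hμ.le, expNeg_ofReal (by positivity),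
        ← ENNReal.ofReal_mul (by positivity), ← ENNReal.ofReal_mul (by positivity),
        ← ENNReal.ofReal_mul (by positivity), mul_assoc, ← Real.exp_add]
      congr 1
      have : -(μ * x) + -(μ * (a * x)) = -(μ * (1 + a) * x) := by ring
      rw [this]
      field_simp
    · rw [indicator_of_notMem (show x ∉ Ici 0 from hx), Pi.mul_apply,
        exponentialPDF_of_neg (not_le.1 hx), zero_mul]
  rw [hfun, lintegral_indicator measurableSet_Ici, lintegral_const_mul _ (by fun_prop),
    lintegral_exp_neg_mul_Ici (by positivity), mul_one]

end Exponential

/-! ### Averaging over the fading -/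

section Fading

variable {Ω : Type*} [MeasurableSpace Ω] {Pr : Measure Ω} {μ : ℝ} {g : ℕ → Ω → ℝ}

/-- The σ-algebra is arbitrary so that it can be the one generated by the gains other than that of
`y`; this gives the independence in `indepFun_tsum_ne`. -/
lemma measurable_tsum_ne {E : Type*} {m : MeasurableSpace E} {f : ℕ → E → ℝ} {y : ℕ}
    (hf : ∀ z, z ≠ y → Measurable (f z)) {a : ℕ → ℝ≥0∞} :
    Measurable fun x => ∑' z, if z = y then 0 else a z * ENNReal.ofReal (f z x) := by
  refine Measurable.tsum fun z => ?_
  by_cases hz : z = y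
  · simp [hz]
  · simp only [hz, if_false]
    exact (hf z hz).ennreal_ofReal.const_mul _

lemma indepFun_tsum_ne (hg : ∀ i, Measurable (g i)) (hind : iIndepFun g Pr) (y : ℕ)
    (a : ℕ → ℝ≥0∞) :
    IndepFun (fun ω => ∑' z, if z = y then 0 else a z * ENNReal.ofReal (g z ω)) (g y) Pr := by
  have h := indep_iSup_of_disjoint (fun i => (hg i).comap_le) hind.iIndep
    (S := {y}ᶜ) (T := {y}) (by simp)
  rw [IndepFun_iff_Indep]
  refine indep_of_indep_of_le_left (indep_of_indep_of_le_right h ?_) ?_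
  · exact le_iSup₂_of_le y rfl le_rfl
  · refine Measurable.comap_le (measurable_tsum_ne fun z hz => ?_)
    exact Measurable.mono (comap_measurable (g z)) (le_iSup₂_of_le z hz le_rfl) le_rfl

lemma lintegral_expNeg_tsum_fading [IsProbabilityMeasure Pr] (hμ : 0 < μ)
    (hg : ∀ i, Measurable (g i)) (hlaw : ∀ i, Pr.map (g i) = expMeasure μ)
    (hind : iIndepFun g Pr) (y : ℕ) {a : ℕ → ℝ} (ha : ∀ z, 0 ≤ a z) :
    ∫⁻ ω, expNeg (ENNReal.ofReal μ *
        ∑' z, if z = y then 0 else ENNReal.ofReal (a z) * ENNReal.ofReal (g z ω)) ∂Pr =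
      expNeg (∑' z, if z = y then 0 else ENNReal.ofReal (Real.log (1 + a z))) := by
  let u : ℕ → ℝ → ℝ≥0∞ := fun z x =>
    ENNReal.ofReal μ * if z = y then 0 else ENNReal.ofReal (a z) * ENNReal.ofReal x
  have hu : ∀ z, Measurable (u z) := by
    intro z
    by_cases hz : z = y
    · simp [u, hz]
    · simp only [u, hz, if_false]; fun_prop
  have hfin : ∀ m : ℕ, ∫⁻ ω, expNeg (∑ z ∈ Finset.range m, u z (g z ω)) ∂Pr =
      expNeg (∑ z ∈ Finset.range m, if z = y then 0 else ENNReal.ofReal (Real.log (1 + a z))) := by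
    intro m
    simp_rw [expNeg_sum]
    rw [lintegral_prod_eq_prod_lintegral_of_indepFun _ (fun z ω => expNeg (u z (g z ω)))
      (hind.comp (fun z x => expNeg (u z x)) fun z => measurable_expNeg.comp (hu z))
      fun z => measurable_expNeg.comp ((hu z).comp (hg z))]
    refine Finset.prod_congr rfl fun z _ => ?_
    rw [← lintegral_map (f := fun x => expNeg (u z x)) (measurable_expNeg.comp (hu z)) (hg z),
      hlaw z]
    by_cases hz : z = y
    · have := isProbabilityMeasure_expMeasure hμ
      simp [u, hz]
    · simp only [u, hz, if_false]
      exact lintegral_expNeg_expMeasure hμ (ha z)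
  refine tendsto_nhds_unique (f := fun m : ℕ => ∫⁻ ω, expNeg (∑ z ∈ Finset.range m, u z (g z ω)) ∂Pr)
    (l := atTop) ?_ ?_
  · refine tendsto_lintegral_of_dominated_convergence (fun _ => 1) (fun n => ?_)
      (fun n => ae_of_all _ fun ω => expNeg_le_one _) (by simp) (ae_of_all _ fun ω => ?_)
    · exact measurable_expNeg.comp (Finset.measurable_sum _ fun z _ => (hu z).comp (hg z))
    · rw [← ENNReal.tsum_mul_left]
      exact expNeg_tsum_eq_tendsto fun z => u z (g z ω)
  · simp_rw [hfin]
    exact expNeg_tsum_eq_tendsto _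

/-- Probability that an exponential gain exceeds a constant plus a weighted sum of the other,
independent, gains. -/
lemma measure_add_tsum_lt_fading [IsProbabilityMeasure Pr] (hμ : 0 < μ)
    (hg : ∀ i, Measurable (g i)) (hlaw : ∀ i, Pr.map (g i) = expMeasure μ)
    (hind : iIndepFun g Pr) (y : ℕ) (A : ℝ≥0∞) {a : ℕ → ℝ} (ha : ∀ z, 0 ≤ a z) :
    Pr {ω | A + ∑' z, (if z = y then 0 else ENNReal.ofReal (a z) * ENNReal.ofReal (g z ω)) <
        ENNReal.ofReal (g y ω)} =
      expNeg (ENNReal.ofReal μ * A +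
        ∑' z, if z = y then 0 else ENNReal.ofReal (Real.log (1 + a z))) := by
  set W : Ω → ℝ≥0∞ := fun ω =>
    ∑' z, if z = y then 0 else ENNReal.ofReal (a z) * ENNReal.ofReal (g z ω) with hW
  have hWm : Measurable W := Measurable.tsum fun z =>
    Measurable.ite (MeasurableSet.const _) measurable_const ((hg z).ennreal_ofReal.const_mul _)
  have := isProbabilityMeasure_expMeasure hμ
  have := Measure.isProbabilityMeasure_map (μ := Pr) hWm.aemeasurable
  have hjoint := (indepFun_iff_map_prod_eq_prod_map_map hWm.aemeasurable (hg y).aemeasurable).1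
    (indepFun_tsum_ne hg hind y fun z => ENNReal.ofReal (a z))
  have hS : MeasurableSet {p : ℝ≥0∞ × ℝ | A + p.1 < ENNReal.ofReal p.2} :=
    measurableSet_lt (by fun_prop) (by fun_prop)
  have h1 : Pr {ω | A + W ω < ENNReal.ofReal (g y ω)} =
      (Pr.map fun ω => (W ω, g y ω)) {p : ℝ≥0∞ × ℝ | A + p.1 < ENNReal.ofReal p.2} := by
    rw [Measure.map_apply (hWm.prodMk (hg y)) hS]; rfl
  -- Given the weighted sum W, the tail of g_y is exp(-μ(A + W)); its mean is the Laplace transform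
  -- of W.
  rw [h1, hjoint, hlaw y, Measure.prod_apply hS]
  simp only [preimage_ofPred_eq]
  simp_rw [expMeasure_lt_ofReal hμ]
  rw [lintegral_map (f := fun x => expNeg (ENNReal.ofReal μ * (A + x)))
    (measurable_expNeg.comp (by fun_prop)) hWm]
  simp_rw [mul_add, expNeg_add]
  rw [lintegral_const_mul _ (show Measurable fun ω => expNeg (ENNReal.ofReal μ * W ω) from
      measurable_expNeg.comp (hWm.const_mul _)), hW,
    lintegral_expNeg_tsum_fading hμ hg hlaw hind y ha]

variable {lam : ℝ} {X : ℕ → Ω → Plane}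

/-- As in `measure_add_tsum_lt_fading`, with weights that depend on the station locations. -/
lemma IsRayleighPoissonNetwork.measure_add_tsum_lt [IsProbabilityMeasure Pr] (hμ : 0 < μ)
    (h : IsRayleighPoissonNetwork Pr lam μ X g) (y : ℕ) {C : Set (ℕ → Plane)}
    (hC : MeasurableSet C) {A : (ℕ → Plane) → ℝ≥0∞} (hA : Measurable A)
    {a : ℕ → (ℕ → Plane) → ℝ} (ham : ∀ z, Measurable (a z)) (ha : ∀ z x, 0 ≤ a z x) :
    MeasurableSet {ω | (fun i => X i ω) ∈ C ∧ A (fun i => X i ω) +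
        ∑' z, (if z = y then 0 else ENNReal.ofReal (a z fun i => X i ω) * ENNReal.ofReal (g z ω)) <
          ENNReal.ofReal (g y ω)} ∧
    Pr {ω | (fun i => X i ω) ∈ C ∧ A (fun i => X i ω) +
        ∑' z, (if z = y then 0 else ENNReal.ofReal (a z fun i => X i ω) * ENNReal.ofReal (g z ω)) <
          ENNReal.ofReal (g y ω)} =
      ∫⁻ ω, C.indicator 1 (fun i => X i ω) * expNeg (ENNReal.ofReal μ * A (fun i => X i ω) +
        ∑' z, if z = y then 0 else ENNReal.ofReal (Real.log (1 + a z fun i => X i ω))) ∂Pr := by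
  have hXm : Measurable fun ω i => X i ω := measurable_pi_lambda _ h.stations.measurable_point
  have hgm : Measurable fun ω i => g i ω := measurable_pi_lambda _ h.measurable_fading
  let S : Set ((ℕ → Plane) × (ℕ → ℝ)) := {p | p.1 ∈ C ∧ A p.1 +
    ∑' z, (if z = y then 0 else ENNReal.ofReal (a z p.1) * ENNReal.ofReal (p.2 z)) <
      ENNReal.ofReal (p.2 y)}
  have hS : MeasurableSet S := by
    refine MeasurableSet.inter (s₂ := {p : (ℕ → Plane) × (ℕ → ℝ) | A p.1 +
      ∑' z, (if z = y then 0 else ENNReal.ofReal (a z p.1) * ENNReal.ofReal (p.2 z)) <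
        ENNReal.ofReal (p.2 y)}) (measurable_fst hC)
      (measurableSet_lt ?_ ?_)
    · refine (hA.comp measurable_fst).add (Measurable.tsum fun z => ?_)
      refine Measurable.ite (MeasurableSet.const _) measurable_const ?_
      exact ((ham z).comp measurable_fst).ennreal_ofReal.mul
        ((measurable_pi_apply z).comp measurable_snd).ennreal_ofReal
    · exact ((measurable_pi_apply y).comp measurable_snd).ennreal_ofReal
  refine ⟨(hXm.prodMk hgm) hS, ?_⟩
  have := Measure.isProbabilityMeasure_map (μ := Pr) hgm.aemeasurable
  have hjoint := (indepFun_iff_map_prod_eq_prod_map_map hXm.aemeasurable hgm.aemeasurable).1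
    h.stations_indep_fading
  have h1 : Pr {ω | (fun i => X i ω) ∈ C ∧ A (fun i => X i ω) +
        ∑' z, (if z = y then 0 else ENNReal.ofReal (a z fun i => X i ω) * ENNReal.ofReal (g z ω)) <
          ENNReal.ofReal (g y ω)} = (Pr.map fun ω => (fun i => X i ω, fun i => g i ω)) S := by
    rw [Measure.map_apply (hXm.prodMk hgm) hS]; rfl
  -- Locations and gains are independent, so by Fubini the locations, and with them the weights, may
  -- be frozen.
  rw [h1, hjoint, Measure.prod_apply hS, lintegral_map (measurable_measure_prodMk_left hS) hXm]
  refine lintegral_congr fun ω => ?_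
  rw [Measure.map_apply hgm (measurable_prodMk_left hS)]
  by_cases hω : (fun i => X i ω) ∈ C
  · rw [indicator_of_mem hω, Pi.one_apply, one_mul,
      ← measure_add_tsum_lt_fading hμ h.measurable_fading h.fading_law h.fading_indep y _
        fun z => ha z _]
    congr 1
    ext ω'
    simp [S, hω]
  · rw [indicator_of_notMem hω, zero_mul]
    convert! measure_empty (μ := Pr)
    ext ω'
    simp [S, hω]

/-- As in `measure_add_tsum_lt_fading`, for the gain of the closest station, with weights that
depend on the station locations. -/
lemma IsRayleighPoissonNetwork.measure_add_tsum_lt_serving [IsProbabilityMeasure Pr] (hμ : 0 < μ)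
    (hlam : 0 < lam) (h : IsRayleighPoissonNetwork Pr lam μ X g)
    {A : ℝ → ℝ≥0∞} (hA : Measurable A)
    {a : ℝ → ℝ → ℝ} (ham : Measurable (Function.uncurry a))
    (ha : ∀ s u, 0 ≤ s → 0 ≤ u → 0 ≤ a s u) :
    NullMeasurableSet {ω | A (‖X (serving X ω) ω‖ ^ 2) + ∑' z, (if z = serving X ω then 0 else
        ENNReal.ofReal (a (‖X (serving X ω) ω‖ ^ 2) (‖X z ω‖ ^ 2)) * ENNReal.ofReal (g z ω)) <
          ENNReal.ofReal (g (serving X ω) ω)} Pr ∧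
    Pr {ω | A (‖X (serving X ω) ω‖ ^ 2) + ∑' z, (if z = serving X ω then 0 else
        ENNReal.ofReal (a (‖X (serving X ω) ω‖ ^ 2) (‖X z ω‖ ^ 2)) * ENNReal.ofReal (g z ω)) <
          ENNReal.ofReal (g (serving X ω) ω)} =
      ∫⁻ ω, expNeg (ENNReal.ofReal μ * A (‖X (serving X ω) ω‖ ^ 2) +
        ∑' z, if z = serving X ω then 0 else
          ENNReal.ofReal (Real.log (1 + a (‖X (serving X ω) ω‖ ^ 2) (‖X z ω‖ ^ 2)))) ∂Pr := by
  have hXm : Measurable fun ω i => X i ω := measurable_pi_lambda _ h.stations.measurable_point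
  -- The configurations in which `y` is strictly closest. These sets are disjoint and almost surely
  -- one of them occurs, so the random serving index can be replaced by a fixed one on each.
  let C : ℕ → Set (ℕ → Plane) := fun y => {x | ∀ j, j ≠ y → ‖x y‖ < ‖x j‖}
  have hC : ∀ y, MeasurableSet (C y) := by
    intro y
    have : C y = ⋂ j, ⋂ _ : j ≠ y, {x | ‖x y‖ < ‖x j‖} := by ext; simp [C]
    rw [this]
    exact MeasurableSet.iInter fun j => MeasurableSet.iInter fun _ =>
      measurableSet_lt (by fun_prop) (by fun_prop)
  have hCd : ∀ {x y z}, x ∈ C y → x ∈ C z → y = z := by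
    intro x y z hy hz
    by_contra hne
    exact (hy z (Ne.symm hne)).asymm (hz y hne)
  have hCs : ∀ {ω y}, (fun i => X i ω) ∈ C y → serving X ω = y := by
    intro ω y hy
    have : {i | IsClosest X ω i} = {y} := by
      ext i
      constructor
      · intro hi
        by_contra hne
        exact (hi y).not_gt (hy i hne)
      · rintro rfl j
        rcases eq_or_ne j i with rfl | hj
        exacts [le_rfl, (hy j hj).le]
    simp [serving, this]
  have hCex : ∀ᵐ ω ∂Pr, (fun i => X i ω) ∈ C (serving X ω) := by
    filter_upwards [h.stations.ae_exists_dyadicFirst hlam] with ω ⟨n, y, hy⟩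
    rw [hy.serving_eq]
    exact fun j hj => hy.norm_lt hj
  let E : ℕ → Set Ω := fun y => {ω | (fun i => X i ω) ∈ C y ∧ A (‖X y ω‖ ^ 2) +
    ∑' z, (if z = y then 0 else
      ENNReal.ofReal (a (‖X y ω‖ ^ 2) (‖X z ω‖ ^ 2)) * ENNReal.ofReal (g z ω)) <
        ENNReal.ofReal (g y ω)}
  have hE := fun y => h.measure_add_tsum_lt hμ y (hC y) (A := fun x => A (‖x y‖ ^ 2))
    (hA.comp (by fun_prop)) (a := fun z x => a (‖x y‖ ^ 2) (‖x z‖ ^ 2))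
    (fun z => ham.comp (f := fun x : ℕ → Plane => (‖x y‖ ^ 2, ‖x z‖ ^ 2)) (by fun_prop))
    (fun z x => ha _ _ (sq_nonneg _) (sq_nonneg _))
  -- The measurability of `serving` is bypassed: the event agrees almost surely with a countable
  -- union of measurable events, hence is null-measurable.
  have hae : {ω | A (‖X (serving X ω) ω‖ ^ 2) + ∑' z, (if z = serving X ω then 0 else
        ENNReal.ofReal (a (‖X (serving X ω) ω‖ ^ 2) (‖X z ω‖ ^ 2)) * ENNReal.ofReal (g z ω)) <
          ENNReal.ofReal (g (serving X ω) ω)} =ᵐ[Pr] ⋃ y, E y := by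
    refine Filter.eventuallyEq_set.2 ?_
    filter_upwards [hCex] with ω hω
    rw [mem_iUnion]
    constructor
    · exact fun hlt => ⟨serving X ω, hω, hlt⟩
    · rintro ⟨y, hy, hlt⟩
      rw [← hCs hy] at hlt
      exact hlt
  have hEm : MeasurableSet (⋃ y, E y) := MeasurableSet.iUnion fun y => (hE y).1
  refine ⟨hEm.nullMeasurableSet.congr hae.symm, ?_⟩
  rw [measure_congr hae, measure_iUnion (fun y z hyz => Set.disjoint_left.2 fun ω hy hz =>
    hyz (hCd hy.1 hz.1)) fun y => (hE y).1]
  rw [tsum_congr fun y => (hE y).2]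
  rw [← lintegral_tsum]
  · refine lintegral_congr_ae ?_
    filter_upwards [hCex] with ω hω
    rw [tsum_eq_single (serving X ω)]
    · rw [indicator_of_mem hω, Pi.one_apply, one_mul]
    · intro y hy
      rw [indicator_of_notMem (fun hy' => hy (hCs hy').symm), zero_mul]
  · intro y
    refine (Measurable.mul ((measurable_one.indicator (hC y)).comp hXm)
      (measurable_expNeg.comp (Measurable.add ?_ (Measurable.tsum fun z => ?_)))).aemeasurable
    · exact (hA.comp ((h.stations.measurable_point y).norm.pow_const 2)).const_mul _
    · refine Measurable.ite (MeasurableSet.const _) measurable_const ?_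
      refine (Real.measurable_log.comp (Measurable.const_add ?_ 1)).ennreal_ofReal
      exact ham.comp (((h.stations.measurable_point y).norm.pow_const 2).prodMk
        ((h.stations.measurable_point z).norm.pow_const 2))

end Fading

/-! ### The path loss integral ρ -/

section PathLoss

lemma integrableOn_one_div_one_add_rpow {p : ℝ} (hp : 1 < p) {a : ℝ} (ha : 0 < a) :
    IntegrableOn (fun u : ℝ => 1 / (1 + u ^ p)) (Ioi a) := by
  refine Integrable.mono' (integrableOn_Ioi_rpow_of_lt (a := -p) (by linarith) ha)
    (Measurable.aestronglyMeasurable (by fun_prop)) ?_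
  filter_upwards [ae_restrict_mem measurableSet_Ioi] with u (hu : a < u)
  have hu0 : 0 < u := ha.trans hu
  have := Real.rpow_pos_of_pos hu0 p
  rw [Real.norm_of_nonneg (by positivity), Real.rpow_neg hu0.le, ← one_div]
  gcongr
  linarith

lemma rhoFactor_nonneg (α : ℝ) {c : ℝ} (hc : 0 ≤ c) : 0 ≤ rhoFactor c α := by
  refine mul_nonneg (Real.rpow_nonneg hc _) (setIntegral_nonneg measurableSet_Ioi fun u hu => ?_)
  have hu0 : 0 < u := (Real.rpow_nonneg hc _).trans_lt hu
  have := Real.rpow_pos_of_pos hu0 (α / 2)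
  positivity

/-- `ρ (c, α)` is the mean interference functional of the complement of the unit disc; the one of the
complement of a disc of squared radius `s` is `s ρ (c, α)`. -/
lemma lintegral_one_sub_expNeg_pathLoss {α c s : ℝ} (hα : 2 < α) (hc : 0 < c) (hs : 0 ≤ s) :
    ∫⁻ u in Ici s, 1 - expNeg (ENNReal.ofReal (Real.log (1 + c * (s / u) ^ (α / 2)))) =
      ENNReal.ofReal (s * rhoFactor c α) := by
  have hp : 1 < α / 2 := by linarith
  rcases hs.eq_or_lt with rfl | hs
  · simp [Real.zero_rpow (by linarith : α / 2 ≠ 0)]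
  -- With this scale, (κu)^(α/2) = c⁻¹(u/s)^(α/2), and the integrand becomes 1/(1 + (κu)^(α/2)). The
  -- substitution sends the lower limit s to c^(-2/α), the one in ρ.
  set κ : ℝ := c ^ (-2 / α) / s with hκ
  have hκ0 : 0 < κ := div_pos (Real.rpow_pos_of_pos hc _) hs
  have hκs : κ * s = c ^ (-2 / α) := by rw [hκ]; field_simp
  have hκinv : κ⁻¹ = s * c ^ (2 / α) := by
    rw [hκ, inv_div, neg_div, Real.rpow_neg hc.le, div_inv_eq_mul]
  have hfun : ∀ u ∈ Ici s, 1 - expNeg (ENNReal.ofReal (Real.log (1 + c * (s / u) ^ (α / 2)))) =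
      ENNReal.ofReal (1 / (1 + (κ * u) ^ (α / 2))) := by
    intro u (hu : s ≤ u)
    have hu0 : 0 < u := hs.trans_le hu
    have hx : 0 < (s / u) ^ (α / 2) := Real.rpow_pos_of_pos (by positivity) _
    have hκu : (κ * u) ^ (α / 2) = c⁻¹ * ((s / u) ^ (α / 2))⁻¹ := by
      have : κ * u = c ^ (-2 / α) * (s / u)⁻¹ := by rw [hκ]; field_simp
      rw [this, Real.mul_rpow (by positivity) (by positivity), ← Real.rpow_mul hc.le,
        Real.inv_rpow (by positivity)]
      have : -2 / α * (α / 2) = -1 := by field_simp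
      rw [this, Real.rpow_neg_one]
    rw [expNeg_ofReal (Real.log_nonneg (by nlinarith [mul_pos hc hx])), Real.exp_neg,
      Real.exp_log (by positivity), ← ENNReal.ofReal_one, ← ENNReal.ofReal_sub _ (by positivity), hκu]
    congr 1
    field_simp
    ring
  have hint : IntegrableOn (fun u => 1 / (1 + (κ * u) ^ (α / 2))) (Ioi s) := by
    have := integrableOn_one_div_one_add_rpow hp (a := κ * s) (by positivity)
    exact (integrableOn_Ioi_comp_mul_left_iff (fun u => 1 / (1 + u ^ (α / 2))) s hκ0).2 this
  rw [setLIntegral_congr_fun measurableSet_Ici hfun, setLIntegral_congr Ioi_ae_eq_Ici.symm,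
    ← ofReal_integral_eq_lintegral_ofReal hint,
    integral_comp_mul_left_Ioi (fun u => 1 / (1 + u ^ (α / 2))) s hκ0, hκs, hκinv, smul_eq_mul,
    mul_assoc, rhoFactor]
  filter_upwards [ae_restrict_mem measurableSet_Ioi] with u (hu : s < u)
  have hu0 : 0 < u := hs.trans hu
  have : 0 < (κ * u) ^ (α / 2) := Real.rpow_pos_of_pos (by positivity) _
  simp only [Pi.zero_apply]
  positivity

/-- For c ≤ 1 the integral in ρ is at most its value from 1 on, finite since α > 2, while the
prefactor c^(2/α) vanishes in the limit. -/
lemma tendsto_rhoFactor_zero {α : ℝ} (hα : 2 < α) :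
    Tendsto (fun n : ℕ => rhoFactor (1 / ((n : ℝ) + 1)) α) atTop (𝓝 0) := by
  have hp : 1 < α / 2 := by linarith
  have hint := integrableOn_one_div_one_add_rpow hp (a := 1) one_pos
  have hlim : Tendsto (fun n : ℕ => (1 / ((n : ℝ) + 1)) ^ (2 / α) *
      ∫ u in Ioi (1 : ℝ), 1 / (1 + u ^ (α / 2))) atTop (𝓝 0) := by
    have h1 : Tendsto (fun n : ℕ => (1 / ((n : ℝ) + 1)) ^ (2 / α)) atTop (𝓝 0) := by
      have := tendsto_one_div_add_atTop_nhds_zero_nat (𝕜 := ℝ).rpow_const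
        (p := 2 / α) (Or.inr (by positivity))
      rwa [Real.zero_rpow (by positivity)] at this
    simpa using h1.mul_const (∫ u in Ioi (1 : ℝ), 1 / (1 + u ^ (α / 2)))
  refine squeeze_zero (fun n => rhoFactor_nonneg α (by positivity)) (fun n => ?_) hlim
  refine mul_le_mul_of_nonneg_left ?_ (by positivity)
  refine setIntegral_mono_set hint ?_ (Ioi_subset_Ioi ?_).eventuallyLE
  · filter_upwards [ae_restrict_mem measurableSet_Ioi] with u (hu : 1 < u)
    have : 0 < u ^ (α / 2) := Real.rpow_pos_of_pos (by linarith) _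
    simp only [Pi.zero_apply]
    positivity
  · refine Real.one_le_rpow_of_pos_of_le_one_of_nonpos (by positivity) ?_ ?_
    · rw [div_le_one (by positivity)]; linarith [Nat.cast_nonneg (α := ℝ) n]
    · exact div_nonpos_of_nonpos_of_nonneg (by norm_num) (by linarith)

end PathLoss

/-! ### Coverage in terms of relative path loss, and convergence of the interference -/

section Coverage

variable {Ω : Type*} [MeasurableSpace Ω] {Pr : Measure Ω} [IsProbabilityMeasure Pr]
  {lam μ : ℝ} {X : ℕ → Ω → Plane} {g : ℕ → Ω → ℝ}

/-- The gain of the closest station exceeds the noise term `c' S_y ^ (α / 2)` plus `c` times the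
interference relative to the path loss of the closest station. -/
def Exceeds (X : ℕ → Ω → Plane) (g : ℕ → Ω → ℝ) (α c c' : ℝ) (ω : Ω) : Prop :=
  ENNReal.ofReal (c' * (‖X (serving X ω) ω‖ ^ 2) ^ (α / 2)) + ∑' z, (if z = serving X ω then 0 else
    ENNReal.ofReal (c * (‖X (serving X ω) ω‖ ^ 2 / ‖X z ω‖ ^ 2) ^ (α / 2)) *
      ENNReal.ofReal (g z ω)) < ENNReal.ofReal (g (serving X ω) ω)

lemma integrableOn_exp_coverage {b α d : ℝ} (hb : 0 < b) (hd : 0 ≤ d) :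
    IntegrableOn (fun v : ℝ => Real.exp (-(b * v) - d * v ^ (α / 2))) (Ioi 0) := by
  refine Integrable.mono' (integrableOn_exp_mul_Ioi (a := -b) (by simpa using hb) 0)
    (Measurable.aestronglyMeasurable (by fun_prop)) ?_
  filter_upwards [ae_restrict_mem measurableSet_Ioi] with v (hv : 0 < v)
  rw [Real.norm_of_nonneg (Real.exp_pos _).le, Real.exp_le_exp]
  have := mul_nonneg hd (Real.rpow_nonneg hv.le (α / 2))
  linarith

lemma IsRayleighPoissonNetwork.measure_exceeds (h : IsRayleighPoissonNetwork Pr lam μ X g)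
    (hlam : 0 < lam) (hμ : 0 < μ) {α c c' : ℝ} (hα : 2 < α) (hc : 0 < c) (hc' : 0 ≤ c') :
    NullMeasurableSet {ω | Exceeds X g α c c' ω} Pr ∧
    Pr {ω | Exceeds X g α c c' ω} = ENNReal.ofReal (lam * Real.pi * ∫ v in Ioi (0 : ℝ),
      Real.exp (-(lam * Real.pi * (1 + rhoFactor c α) * v) - μ * c' * v ^ (α / 2))) := by
  have hpi := Real.pi_pos
  have hp : 0 < α / 2 := by linarith
  have hρ := rhoFactor_nonneg α hc.le
  obtain ⟨h1, h2⟩ := h.measure_add_tsum_lt_serving hμ hlam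
    (A := fun s => ENNReal.ofReal (c' * s ^ (α / 2))) (by fun_prop)
    (a := fun s u => c * (s / u) ^ (α / 2)) (by unfold Function.uncurry; fun_prop)
    (fun s u hs hu => by positivity)
  refine ⟨h1, ?_⟩
  refine h2.trans ?_
  have hcont : ∀ u : ℝ, Continuous fun s : ℝ => c * (s / u) ^ (α / 2) := fun u =>
    continuous_const.mul ((continuous_id.div_const u).rpow_const fun _ => Or.inr hp.le)
  have hserv := h.stations.lintegral_serving hlam
    (A := fun s => ENNReal.ofReal μ * ENNReal.ofReal (c' * s ^ (α / 2)))
    -- The truncation max s 0 makes the exponent continuous on the whole line; it changes nothing at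
    -- squared distances.
    (ℓ := fun s u => ENNReal.ofReal (Real.log (1 + c * ((max s 0) / u) ^ (α / 2))))
    (ρ := rhoFactor c α) ?_ (fun s => by fun_prop) ?_ ?_ ?_
  · simp only [max_eq_left (sq_nonneg _)] at hserv
    rw [hserv, setLIntegral_congr Ioi_ae_eq_Ici.symm,
      ENNReal.ofReal_mul (p := lam * Real.pi) (by positivity), ofReal_integral_eq_lintegral_ofReal
        (integrableOn_exp_coverage (by positivity) (by positivity))
        (ae_of_all _ fun _ => (Real.exp_pos _).le), ← lintegral_const_mul _ (by fun_prop)]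
    refine setLIntegral_congr_fun measurableSet_Ioi fun v (hv : 0 < v) => ?_
    rw [← ENNReal.ofReal_mul (p := lam * Real.pi) (q := v * rhoFactor c α) (by positivity),
      ← ENNReal.ofReal_mul hμ.le, expNeg_ofReal (by positivity), expNeg_ofReal (by positivity),
      mul_assoc, mul_assoc, ← ENNReal.ofReal_mul (Real.exp_pos _).le,
      ← ENNReal.ofReal_mul (Real.exp_pos _).le, ← Real.exp_add, ← Real.exp_add]
    congr 3; ring
  · refine ENNReal.continuous_const_mul ENNReal.ofReal_ne_top |>.comp
      (ENNReal.continuous_ofReal.comp ?_)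
    exact continuous_const.mul (continuous_id.rpow_const fun _ => Or.inr hp.le)
  · intro u hu s (hs : 0 ≤ s) t (ht : 0 ≤ t) hst
    simp only [max_eq_left hs, max_eq_left ht]
    gcongr
  · intro u hu
    refine ENNReal.continuous_ofReal.comp (Continuous.log ?_ fun s => ?_)
    · exact continuous_const.add ((hcont u).comp (continuous_id.max continuous_const))
    · have : 0 ≤ c * (max s 0 / u) ^ (α / 2) := by positivity
      linarith
  · intro s hs
    simp only [max_eq_left hs]
    exact lintegral_one_sub_expNeg_pathLoss hα hc hs

/-- Without noise, the event that c times the sum is below the serving gain has probability 1/(1 +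
ρ(c, α)) and forces the sum to be finite. Letting c = 1/(n + 1) tend to 0 makes this probability
tend to 1. -/
lemma IsRayleighPoissonNetwork.ae_relative_interference_ne_top
    (h : IsRayleighPoissonNetwork Pr lam μ X g)
    (hlam : 0 < lam) (hμ : 0 < μ) {α : ℝ} (hα : 2 < α) :
    ∀ᵐ ω ∂Pr, ∑' z, (if z = serving X ω then 0 else
      ENNReal.ofReal ((‖X (serving X ω) ω‖ ^ 2 / ‖X z ω‖ ^ 2) ^ (α / 2)) *
        ENNReal.ofReal (g z ω)) ≠ ∞ := by
  have hpi := Real.pi_pos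
  let c : ℕ → ℝ := fun n => 1 / ((n : ℝ) + 1)
  have hc : ∀ n, 0 < c n := fun n => by positivity
  have hE := fun n => h.measure_exceeds hlam hμ hα (hc n) le_rfl
  have hval : ∀ n, Pr {ω | Exceeds X g α (c n) 0 ω} =
      ENNReal.ofReal (1 / (1 + rhoFactor (c n) α)) := by
    intro n
    have hρ := rhoFactor_nonneg α (hc n).le
    rw [(hE n).2]
    congr 1
    simp only [mul_zero, zero_mul, sub_zero]
    have : ∀ v : ℝ, -(lam * Real.pi * (1 + rhoFactor (c n) α) * v) =
      -(lam * Real.pi * (1 + rhoFactor (c n) α)) * v := fun v => by ring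
    simp_rw [this]
    rw [integral_exp_mul_Ioi (by simp; positivity)]
    simp
    field_simp
  have hlim : Tendsto (fun n => ENNReal.ofReal (1 / (1 + rhoFactor (c n) α))) atTop (𝓝 1) := by
    have := (tendsto_rhoFactor_zero hα).const_add 1
    have := (tendsto_const_nhds (x := (1 : ℝ))).div this (by norm_num)
    rw [add_zero, div_one] at this
    rw [← ENNReal.ofReal_one]
    exact ENNReal.tendsto_ofReal this
  have hunion : NullMeasurableSet (⋃ n, {ω | Exceeds X g α (c n) 0 ω}) Pr :=
    NullMeasurableSet.iUnion fun n => (hE n).1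
  have h1 : 1 ≤ Pr (⋃ n, {ω | Exceeds X g α (c n) 0 ω}) := by
    refine le_of_tendsto' hlim fun n => ?_
    rw [← hval n]
    exact measure_mono (subset_iUnion (fun n => {ω | Exceeds X g α (c n) 0 ω}) n)
  have h0 : Pr (⋃ n, {ω | Exceeds X g α (c n) 0 ω})ᶜ = 0 := by
    rw [prob_compl_eq_zero_iff₀ hunion]
    exact le_antisymm prob_le_one h1
  filter_upwards [measure_eq_zero_iff_ae_notMem.1 h0] with ω hω
  simp only [mem_compl_iff, not_not, mem_iUnion] at hω
  obtain ⟨n, hn⟩ := hω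
  have hlt : ENNReal.ofReal (c n) * ∑' z, (if z = serving X ω then 0 else
      ENNReal.ofReal ((‖X (serving X ω) ω‖ ^ 2 / ‖X z ω‖ ^ 2) ^ (α / 2)) *
        ENNReal.ofReal (g z ω)) < ∞ := by
    rw [← ENNReal.tsum_mul_left]
    refine lt_of_le_of_lt ?_ (lt_top_of_lt hn)
    refine le_trans (le_of_eq (tsum_congr fun z => ?_)) le_add_self
    by_cases hz : z = serving X ω
    · simp [hz]
    · simp only [hz, if_false]
      rw [← mul_assoc, ← ENNReal.ofReal_mul (hc n).le]
  intro htop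
  rw [htop, ENNReal.mul_top (by simpa using hc n)] at hlt
  exact hlt.ne rfl

end Coverage

/-! ### From the SINR to the coverage function -/

section SINR

variable {Ω : Type*} [MeasurableSpace Ω] {Pr : Measure Ω} [IsProbabilityMeasure Pr]
  {lam μ : ℝ} {X : ℕ → Ω → Plane} {g : ℕ → Ω → ℝ}

/-- A single point has area 0, so its count is Poisson with parameter 0. This excludes stations at
the origin, where negative powers and quotients of distances take default values. -/
lemma IsPoissonPointProcess.ae_norm_pos (h : IsPoissonPointProcess Pr lam X) :
    ∀ᵐ ω ∂Pr, ∀ i, 0 < ‖X i ω‖ := by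
  have h0 : Pr {ω | pointCount X {0} ω = ((0 : ℕ) : ℕ∞)} = 1 := by
    rw [h.count_law _ (measurableSet_singleton 0) (by simp), poissonMeasure_singleton]
    simp [measureReal_def]
  have hm : MeasurableSet {ω | pointCount X {0} ω = ((0 : ℕ) : ℕ∞)} :=
    measurable_pointCount h.measurable_point (measurableSet_singleton 0) (measurableSet_singleton _)
  filter_upwards [(mem_ae_iff_prob_eq_one hm).2 h0] with ω hω i
  have hω : {i | X i ω ∈ ({0} : Set Plane)}.encard = 0 := hω
  rw [Set.encard_eq_zero] at hω
  refine norm_pos_iff.2 fun hi => ?_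
  have : i ∈ {i | X i ω ∈ ({0} : Set Plane)} := hi
  rw [hω] at this
  exact this

lemma IsRayleighPoissonNetwork.ae_fading_pos (h : IsRayleighPoissonNetwork Pr lam μ X g)
    (hμ : 0 < μ) : ∀ᵐ ω ∂Pr, ∀ i, 0 < g i ω := by
  rw [ae_all_iff]
  intro i
  have := isProbabilityMeasure_expMeasure hμ
  have h1 : Pr {ω | 0 < g i ω} = 1 := by
    have : {ω | 0 < g i ω} = g i ⁻¹' {x | (0 : ℝ≥0∞) < ENNReal.ofReal x} := by ext; simp
    rw [this, ← Measure.map_apply (h.measurable_fading i)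
      (measurableSet_lt measurable_const ENNReal.measurable_ofReal), h.fading_law i,
      expMeasure_lt_ofReal hμ]
    simp
  exact (mem_ae_iff_prob_eq_one (measurableSet_lt measurable_const (h.measurable_fading i))).2 h1

lemma sq_div_sq_rpow {a b : ℝ} (ha : 0 < a) (hb : 0 < b) (α : ℝ) :
    (a ^ 2 / b ^ 2) ^ (α / 2) = a ^ α * b ^ (-α) := by
  rw [← div_pow, ← Real.rpow_natCast, ← Real.rpow_mul (by positivity), Real.div_rpow ha.le hb.le,
    Real.rpow_neg hb.le, Nat.cast_ofNat, mul_div_cancel₀ α (two_ne_zero), div_eq_mul_inv]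

omit [MeasurableSpace Ω] in
lemma ofReal_relative_interferenceTerm {α : ℝ} {ω : Ω} (hX : ∀ i, 0 < ‖X i ω‖)
    {c : ℝ} (hc : 0 ≤ c) (z : ℕ) :
    (if z = serving X ω then 0 else
      ENNReal.ofReal (c * (‖X (serving X ω) ω‖ ^ 2 / ‖X z ω‖ ^ 2) ^ (α / 2)) *
        ENNReal.ofReal (g z ω)) =
      ENNReal.ofReal (c * ‖X (serving X ω) ω‖ ^ α) *
        ENNReal.ofReal (interferenceTerm α X g ω z) := by
  by_cases hz : z = serving X ω
  · simp [hz, interferenceTerm]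
  · have h1 := Real.rpow_nonneg (hX (serving X ω)).le α
    have h2 := Real.rpow_nonneg (hX z).le (-α)
    simp only [hz, if_false, interferenceTerm]
    rw [sq_div_sq_rpow (hX _) (hX z), ← ENNReal.ofReal_mul (by positivity),
      ← ENNReal.ofReal_mul (by positivity)]
    congr 1; ring

omit [MeasurableSpace Ω] in
lemma interferenceTerm_nonneg {α : ℝ} {ω : Ω} (hg : ∀ i, 0 < g i ω) (z : ℕ) :
    0 ≤ interferenceTerm α X g ω z := by
  unfold interferenceTerm
  split_ifs
  · exact le_rfl
  · exact mul_nonneg (hg z).le (Real.rpow_nonneg (norm_nonneg _) _)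

lemma IsRayleighPoissonNetwork.ae_summable_interferenceTerm
    (h : IsRayleighPoissonNetwork Pr lam μ X g) (hlam : 0 < lam) (hμ : 0 < μ) {α : ℝ}
    (hα : 2 < α) : ∀ᵐ ω ∂Pr, Summable (interferenceTerm α X g ω) := by
  filter_upwards [h.ae_relative_interference_ne_top hlam hμ hα, h.stations.ae_norm_pos,
    h.ae_fading_pos hμ] with ω hsum hX hg
  have hterm := ofReal_relative_interferenceTerm (g := g) (α := α) hX zero_le_one
  simp only [one_mul] at hterm
  simp_rw [hterm] at hsum
  rw [ENNReal.tsum_mul_left] at hsum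
  have hr : 0 < ‖X (serving X ω) ω‖ ^ α := Real.rpow_pos_of_pos (hX _) _
  have hne : ∑' z, ENNReal.ofReal (interferenceTerm α X g ω z) ≠ ∞ := by
    intro htop
    rw [htop, ENNReal.mul_top (by simpa using hr)] at hsum
    exact hsum rfl
  have := ENNReal.summable_toReal hne
  simpa only [ENNReal.toReal_ofReal (interferenceTerm_nonneg hg _)] using this

omit [MeasurableSpace Ω] in
-- The inequality is solved for the serving gain: multiply by the denominator and by r^α, divide by
-- P. Convergence of the interference permits the passage from real sums to sums in [0, ∞].
lemma lt_sfrSINR_iff_exceeds {P σ α β t : ℝ} {Δ : ℕ} (hP : 0 < P)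
    (hη : 0 < effectiveFactor Δ β) (ht : 0 < t) {ω : Ω} (hX : ∀ i, 0 < ‖X i ω‖)
    (hg : ∀ i, 0 < g i ω) (hsum : Summable (interferenceTerm α X g ω)) :
    t < sfrSINR P σ α Δ β X g ω ↔
      Exceeds X g α (effectiveFactor Δ β * t) (t * (σ ^ 2 / P)) ω := by
  set η := effectiveFactor Δ β with hηdef
  set y := serving X ω with hy
  have hnn := interferenceTerm_nonneg (X := X) (α := α) hg
  -- Station y + 1 is always an interferer, so the denominator of the SINR is positive even without
  -- noise.
  have hI : 0 < interference α X g ω := by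
    refine hsum.tsum_pos hnn (y + 1) ?_
    have : y + 1 ≠ serving X ω := by rw [← hy]; omega
    rw [interferenceTerm, if_neg this]
    exact mul_pos (hg _) (Real.rpow_pos_of_pos (hX _) _)
  have hr : 0 < ‖X y ω‖ ^ α := Real.rpow_pos_of_pos (hX y) α
  have hden : 0 < σ ^ 2 + η * P * interference α X g ω := by positivity
  have hpow : (‖X y ω‖ ^ 2) ^ (α / 2) = ‖X y ω‖ ^ α := by
    rw [← Real.rpow_natCast, ← Real.rpow_mul (norm_nonneg _), Nat.cast_ofNat,
      mul_div_cancel₀ α two_ne_zero]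
  rw [Exceeds, tsum_congr fun z => ofReal_relative_interferenceTerm (g := g) (α := α) hX
      (by positivity : 0 ≤ η * t) z, ENNReal.tsum_mul_left, ← ENNReal.ofReal_tsum_of_nonneg hnn hsum,
    ← hy, hpow, ← ENNReal.ofReal_mul (by positivity),
    ← ENNReal.ofReal_add (by positivity) (mul_nonneg (by positivity) (tsum_nonneg hnn)),
    ENNReal.ofReal_lt_ofReal_iff (hg y), sfrSINR, ← hηdef, ← hy, lt_div_iff₀ hden,
    Real.rpow_neg (norm_nonneg _), ← interference, ← div_eq_mul_inv, lt_div_iff₀ hr]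
  have e : t * (σ ^ 2 / P) * ‖X y ω‖ ^ α + η * t * ‖X y ω‖ ^ α * interference α X g ω =
      t * (σ ^ 2 + η * P * interference α X g ω) * ‖X y ω‖ ^ α / P := by
    field_simp
  rw [e, div_lt_iff₀ hP, mul_comm P]

/-- In the noise term η cancels: ηt · σ²/(ηP) = t σ²/P. This is why the transmit power in p_c has to
be ηP, although the station serves with P. -/
lemma coverageFn_effectiveFactor {P η t : ℝ} (hP : 0 < P) (hη : 0 < η) (μ σ lam α : ℝ) :
    coverageFn μ σ (η * P) (η * t) lam α 1 =
      lam * Real.pi * ∫ v in Ioi (0 : ℝ), Real.exp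
        (-(lam * Real.pi * (1 + rhoFactor (η * t) α) * v) - μ * (t * (σ ^ 2 / P)) * v ^ (α / 2)) := by
  rw [coverageFn, mul_comm Real.pi lam]
  congr 2
  ext v
  congr 1
  field_simp
  simp
  ring

/-- Tail of the SINR. -/
lemma IsRayleighPoissonNetwork.measure_lt_sfrSINR (h : IsRayleighPoissonNetwork Pr lam μ X g)
    (hlam : 0 < lam) (hμ : 0 < μ) {P σ α β t : ℝ} {Δ : ℕ} (hP : 0 < P) (hα : 2 < α)
    (hη : 0 < effectiveFactor Δ β) (ht : 0 < t) :
    NullMeasurableSet {ω | t < sfrSINR P σ α Δ β X g ω} Pr ∧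
    Pr {ω | t < sfrSINR P σ α Δ β X g ω} = ENNReal.ofReal
      (coverageFn μ σ (effectiveFactor Δ β * P) (effectiveFactor Δ β * t) lam α 1) := by
  have hae : {ω | t < sfrSINR P σ α Δ β X g ω} =ᵐ[Pr]
      {ω | Exceeds X g α (effectiveFactor Δ β * t) (t * (σ ^ 2 / P)) ω} := by
    refine Filter.eventuallyEq_set.2 ?_
    filter_upwards [h.ae_summable_interferenceTerm hlam hμ hα, h.stations.ae_norm_pos,
      h.ae_fading_pos hμ] with ω hsum hX hg
    exact lt_sfrSINR_iff_exceeds hP hη ht hX hg hsum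
  obtain ⟨h1, h2⟩ := h.measure_exceeds hlam hμ hα (mul_pos hη ht)
    (by positivity : 0 ≤ t * (σ ^ 2 / P))
  refine ⟨h1.congr hae.symm, ?_⟩
  rw [measure_congr hae, h2, coverageFn_effectiveFactor hP hη]

lemma coverageFn_effectiveFactor_pos {P η t : ℝ} (hP : 0 < P) (hη : 0 < η) (ht : 0 < t)
    {μ lam α : ℝ} (hμ : 0 < μ) (hlam : 0 < lam) (σ : ℝ) :
    0 < coverageFn μ σ (η * P) (η * t) lam α 1 := by
  have hpi := Real.pi_pos
  have hρ := rhoFactor_nonneg α (mul_pos hη ht).le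
  rw [coverageFn_effectiveFactor hP hη]
  refine mul_pos (by positivity) ?_
  refine (setIntegral_pos_iff_support_of_nonneg_ae (ae_of_all _ fun _ => (Real.exp_pos _).le)
    (integrableOn_exp_coverage (by positivity) (by positivity))).2 ?_
  have : (Function.support fun v : ℝ => Real.exp
      (-(lam * Real.pi * (1 + rhoFactor (η * t) α) * v) - μ * (t * (σ ^ 2 / P)) * v ^ (α / 2))) =
      univ := by
    ext v; simp [Real.exp_ne_zero]
  rw [this]; simp

lemma effectiveFactor_pos {Δ : ℕ} {β : ℝ} (hΔ : 1 ≤ Δ) (hβ : 1 ≤ β) : 0 < effectiveFactor Δ β := by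
  have : (1 : ℝ) ≤ Δ := by exact_mod_cast hΔ
  exact div_pos (by linarith) (by linarith)

end SINR

end

theorem theorem4 {Ω : Type*} [MeasurableSpace Ω] (Pr : Measure Ω) [IsProbabilityMeasure Pr]
    (lam μ P σ α β T TR : ℝ) (Δ : ℕ)
    (hlam : 0 < lam) (hμ : 0 < μ) (hP : 0 < P) (hα : 2 < α) (hβ : 1 ≤ β) (hΔ : 1 ≤ Δ)
    (hTR : 0 < TR)
    (X : ℕ → Ω → Plane) (g : ℕ → Ω → ℝ) (hnet : IsRayleighPoissonNetwork Pr lam μ X g) :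
    (∀ᵐ ω ∂Pr, (∃! i, IsClosest X ω i) ∧ Summable (interferenceTerm α X g ω)) ∧
    0 < Pr (sfrInterior P σ α Δ β TR X g) ∧
    sfrInteriorCoverage Pr P σ α Δ β TR T X g =
      coverageFn μ σ (effectiveFactor Δ β * P) (effectiveFactor Δ β * max T TR) lam α 1 /
        coverageFn μ σ (effectiveFactor Δ β * P) (effectiveFactor Δ β * TR) lam α 1 := by
  have hη := effectiveFactor_pos hΔ hβ
  have hTm : 0 < max T TR := lt_max_of_lt_right hTR
  obtain ⟨hnull, hR⟩ := hnet.measure_lt_sfrSINR (σ := σ) hlam hμ hP hα hη hTR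
  obtain ⟨-, hM⟩ := hnet.measure_lt_sfrSINR (σ := σ) hlam hμ hP hα hη hTm
  have hpR := coverageFn_effectiveFactor_pos (α := α) hP hη hTR hμ hlam σ
  have hpM := coverageFn_effectiveFactor_pos (α := α) hP hη hTm hμ hlam σ
  refine ⟨?_, ?_, ?_⟩
  · filter_upwards [hnet.stations.ae_exists_dyadicFirst hlam,
      hnet.ae_summable_interferenceTerm hlam hμ hα] with ω ⟨n, y, hy⟩ hsum
    exact ⟨⟨y, (hy.isClosest_iff y).2 rfl, fun i hi => (hy.isClosest_iff i).1 hi⟩, hsum⟩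
  · rw [sfrInterior, hR]
    exact ENNReal.ofReal_pos.2 hpR
  · have hinter : {ω | T < sfrSINR P σ α Δ β X g ω} ∩ {ω | TR < sfrSINR P σ α Δ β X g ω} =
        {ω | max T TR < sfrSINR P σ α Δ β X g ω} := by
      ext ω; simp
    -- Null-measurability of the conditioning event suffices here, so T may be any real number,
    -- including T ≤ 0, for which no tail formula is available.
    rw [sfrInteriorCoverage, measureReal_def, ProbabilityTheory.cond, Measure.smul_apply,
      sfrInterior, Measure.restrict_apply₀' hnull, hinter, hR, hM, smul_eq_mul, ENNReal.toReal_mul,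
      ENNReal.toReal_inv, ENNReal.toReal_ofReal hpR.le, ENNReal.toReal_ofReal hpM.le,
      div_eq_inv_mul]
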